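/- All Hilbert spaces are finite-dimensional, $S(\rho)=-\mathrm{Tr}\,\rho\log\rho$ is the von Neumann entropy (natural logarithm, $0\log 0=0$), $H(p)=-\sum_i p_i\log p_i$, and $S_X$ denotes the entropy of the reduced state on the subsystem $X$; $I_{A:B}=S_A+S_B-S_{AB}$ and $I_{A:B|V}=S_{AV}+S_{BV}-S_{ABV}-S_V$. An extension of a state $\rho_{AB}$ is a state $\rho_{ABV}$, with $V$ of arbitrary finite dimension, such that $\mathrm{Tr}_V\rho_{ABV}=\rho_{AB}$. Put $$E_P(\rho_{AB})=\inf S_{AV},\qquad E_Q(\rho_{AB})=\inf \tfrac12\,(S_A+S_B+S_{AV}-S_{BV}),$$ $$E_R(\rho_{AB})=\inf \tfrac12\,(S_{AB}+2S_{AV}-S_{ABV}-S_V),\qquad E_{sq}(\rho_{AB})=\inf \tfrac12\, I_{A:B|V},$$ each infimum being over all extensions $\rho_{ABV}$ of $\rho_{AB}$. 1. (Pure states.) For every pure state $|\psi\rangle_{AB}$, $E_P=E_Q=E_R=S_A=S_B$. 2. (Classically correlated states.) For every probability distribution $(p_i)$, the state $\rho_{AB}=\sum_i p_i|ii\rangle\langle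 ii|$ satisfies $S_A=I_{A:B}=H(p)$, $E_P=E_Q=H(p)$ and $E_R=\tfrac12 H(p)$. 3. (Symmetric or antisymmetric states.) Let $\mathcal H_A=\mathcal H_B$ and let $\rho_{AB}$ be a state whose support lies in the symmetric subspace, or in the antisymmetric subspace, of $\mathcal H_A\otimes\mathcal H_B$. Then every extension is swap invariant, $(F_{AB}\otimes I_V)\,\rho_{ABV}\,(F_{AB}^\dagger\otimes I_V)=\rho_{ABV}$ with $F_{AB}=\sum_{ij}|ij\rangle\langle ji|$, and has $S_{AV}=S_{BV}$. Moreover $E_P=E_Q=S_A$ and $E_R=\tfrac12 S_{AB}+E_{sq}$. 4. $E_P$ is additive on the class of states in 3: if $\rho_{A_1B_1}$ and $\tau_{A_2B_2}$ both belong to this class, then $E_P(\rho_{A_1B_1}\otimes\tau_{A_2B_2})=E_P(\rho_{A_1B_1})+E_P(\tau_{A_2B_2})$, where the product is regarded as a bipartite state of $A_1A_2$ and $B_1B_2$. -/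

import Mathlib

open scoped Kronecker ComplexOrder

noncomputable section

namespace QCorr

/-- A density operator on the Hilbert space `ℂ^A`: positive semidefinite with unit trace. -/
structure IsState {A : Type*} [Fintype A] (ρ : Matrix A A ℂ) : Prop where
  posSemidef : ρ.PosSemidef
  trace_eq_one : ρ.trace = 1

/-- The von Neumann entropy `S(ρ) = -Tr (ρ log ρ)` (natural logarithm). The logarithm is taken
by functional calculus; as `Real.log 0 = 0`, the usual convention `0 log 0 = 0` holds. -/
def entropy {A : Type*} [Fintype A] [DecidableEq A] (ρ : Matrix A A ℂ) : ℝ :=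
  -((ρ * cfc Real.log ρ).trace).re

/-- The Shannon entropy `H(p) = -∑ i, p i log (p i)`. -/
def shannon {ι : Type*} [Fintype ι] (p : ι → ℝ) : ℝ :=
  -∑ i, p i * Real.log (p i)

/-- The partial trace over the second factor. -/
def trRight {X Y : Type*} [Fintype Y] (ρ : Matrix (X × Y) (X × Y) ℂ) : Matrix X X ℂ :=
  Matrix.of fun x x' => ∑ y, ρ (x, y) (x', y)

/-- The partial trace over the first factor. -/
def trLeft {X Y : Type*} [Fintype X] (ρ : Matrix (X × Y) (X × Y) ℂ) : Matrix Y Y ℂ :=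
  Matrix.of fun y y' => ∑ x, ρ (x, y) (x, y')

section Tripartite

variable {A B V : Type*}

/-- The marginal on `AV` of an operator on `ABV`. -/
def margAV [Fintype B] (σ : Matrix ((A × B) × V) ((A × B) × V) ℂ) : Matrix (A × V) (A × V) ℂ :=
  Matrix.of fun x x' => ∑ b, σ ((x.1, b), x.2) ((x'.1, b), x'.2)

/-- The marginal on `BV` of an operator on `ABV`. -/
def margBV [Fintype A] (σ : Matrix ((A × B) × V) ((A × B) × V) ℂ) : Matrix (B × V) (B × V) ℂ :=
  Matrix.of fun x x' => ∑ a, σ ((a, x.1), x.2) ((a, x'.1), x'.2)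

/-- `σ` is an extension to `ABV` of the operator `ρ` on `AB`: a state with `Tr_V σ = ρ`. -/
structure IsExtension [Fintype A] [Fintype B] [Fintype V]
    (ρ : Matrix (A × B) (A × B) ℂ) (σ : Matrix ((A × B) × V) ((A × B) × V) ℂ) : Prop where
  isState : IsState σ
  trRight_eq : trRight σ = ρ

variable [Fintype A] [Fintype B] [Fintype V] [DecidableEq A] [DecidableEq B] [DecidableEq V]

/-- The mutual information `I_{A:B} = S_A + S_B - S_{AB}`. -/
def mutualInfo (ρ : Matrix (A × B) (A × B) ℂ) : ℝ :=
  entropy (trRight ρ) + entropy (trLeft ρ) - entropy ρ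

/-- The conditional mutual information `I_{A:B|V} = S_{AV} + S_{BV} - S_{ABV} - S_V`. -/
def condMutualInfo (σ : Matrix ((A × B) × V) ((A × B) × V) ℂ) : ℝ :=
  entropy (margAV σ) + entropy (margBV σ) - entropy σ - entropy (trLeft σ)

/-- `f^P = S_{AV}`. -/
def fP (σ : Matrix ((A × B) × V) ((A × B) × V) ℂ) : ℝ :=
  entropy (margAV σ)

/-- `f^Q = (S_A + S_B + S_{AV} - S_{BV}) / 2`. -/
def fQ (σ : Matrix ((A × B) × V) ((A × B) × V) ℂ) : ℝ :=
  (1 / 2) * (entropy (trRight (trRight σ)) + entropy (trLeft (trRight σ))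
    + entropy (margAV σ) - entropy (margBV σ))

/-- `f^R = (S_{AB} + 2 S_{AV} - S_{ABV} - S_V) / 2`. -/
def fR (σ : Matrix ((A × B) × V) ((A × B) × V) ℂ) : ℝ :=
  (1 / 2) * (entropy (trRight σ) + 2 * entropy (margAV σ) - entropy σ - entropy (trLeft σ))

end Tripartite

section Measures

variable {A B : Type*} [Fintype A] [Fintype B] [DecidableEq A] [DecidableEq B]

/-- The infimum of `f` over all extensions `ρ_{ABV}` of `ρ` with `V = ℂ^n` of arbitrary finite
dimension. It is taken in the extended reals, so that it is a genuine infimum. -/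
def infExt (f : ∀ n : ℕ, Matrix ((A × B) × Fin n) ((A × B) × Fin n) ℂ → ℝ)
    (ρ : Matrix (A × B) (A × B) ℂ) : EReal :=
  ⨅ (n : ℕ) (σ : Matrix ((A × B) × Fin n) ((A × B) × Fin n) ℂ) (_ : IsExtension ρ σ),
    (f n σ : EReal)

/-- The entanglement of purification. -/
def EP (ρ : Matrix (A × B) (A × B) ℂ) : EReal := infExt (fun _ σ => fP σ) ρ

/-- The correlation measure `E_Q`. -/
def EQ (ρ : Matrix (A × B) (A × B) ℂ) : EReal := infExt (fun _ σ => fQ σ) ρ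

/-- The correlation measure `E_R`. -/
def ER (ρ : Matrix (A × B) (A × B) ℂ) : EReal := infExt (fun _ σ => fR σ) ρ

/-- The squashed entanglement, `inf I_{A:B|V} / 2`. -/
def Esq (ρ : Matrix (A × B) (A × B) ℂ) : EReal :=
  infExt (fun _ σ => (1 / 2) * condMutualInfo σ) ρ

end Measures

/-- The operator `|ψ⟩⟨ψ|`. -/
def pureOp {X : Type*} (ψ : X → ℂ) : Matrix X X ℂ :=
  Matrix.vecMulVec ψ (star ψ)

section Examples

variable {ι : Type*} [DecidableEq ι]

/-- The classically correlated state `∑ i, p i |ii⟩⟨ii|`. -/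
def classicalState [Fintype ι] (p : ι → ℝ) : Matrix (ι × ι) (ι × ι) ℂ :=
  ∑ i, (p i : ℂ) • pureOp (Pi.single (i, i) 1)

/-- The swap operator `F = ∑ i j, |ij⟩⟨ji|`. -/
def swapOp : Matrix (ι × ι) (ι × ι) ℂ :=
  Matrix.of fun x y => if x = y.swap then 1 else 0

variable (ι) in
/-- The symmetric subspace of `ℂ^ι ⊗ ℂ^ι`. -/
def symSubspace : Submodule ℂ (ι × ι → ℂ) where
  carrier := {x | ∀ i j, x (j, i) = x (i, j)}
  add_mem' := fun hx hy i j => by simp only [Pi.add_apply, hx i j, hy i j]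
  zero_mem' := fun _ _ => rfl
  smul_mem' := fun c x hx i j => by simp only [Pi.smul_apply, hx i j]

variable (ι) in
/-- The antisymmetric subspace of `ℂ^ι ⊗ ℂ^ι`. -/
def antisymSubspace : Submodule ℂ (ι × ι → ℂ) where
  carrier := {x | ∀ i j, x (j, i) = -x (i, j)}
  add_mem' := fun hx hy i j => by
    simp only [Pi.add_apply, hx i j, hy i j]
    ring
  zero_mem' := fun _ _ => by simp
  smul_mem' := fun c x hx i j => by simp only [Pi.smul_apply, hx i j, smul_neg]

/-- A state on `ℂ^ι ⊗ ℂ^ι` whose support lies within the symmetric subspace, or within the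
antisymmetric subspace. The support of a positive semidefinite operator is its range. -/
structure IsSymOrAntisymState [Fintype ι] (ρ : Matrix (ι × ι) (ι × ι) ℂ) : Prop where
  isState : IsState ρ
  support_le : LinearMap.range ρ.mulVecLin ≤ symSubspace ι ∨
    LinearMap.range ρ.mulVecLin ≤ antisymSubspace ι

end Examples

/-- The tensor product of an operator on `A₁B₁` and one on `A₂B₂`, as an operator on the bipartite
system with parts `A₁A₂` and `B₁B₂`. -/
def bipartiteTensor {A₁ B₁ A₂ B₂ : Type*} (ρ : Matrix (A₁ × B₁) (A₁ × B₁) ℂ)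
    (τ : Matrix (A₂ × B₂) (A₂ × B₂) ℂ) :
    Matrix ((A₁ × A₂) × (B₁ × B₂)) ((A₁ × A₂) × (B₁ × B₂)) ℂ :=
  Matrix.of fun x y => ρ (x.1.1, x.2.1) (y.1.1, y.2.1) * τ (x.1.2, x.2.2) (y.1.2, y.2.2)

end QCorr

end

/-!
Everything rests on weak monotonicity `S_A + S_B ≤ S_{AV} + S_{BV}` and strong subadditivity
`0 ≤ I_{A:B|V}`, both of which follow from the monotonicity of the relative entropy under partial
traces. Monotonicity is in turn obtained from the integral representation of the relative entropy by
resolvents of the modular operator: each of its resolvents is the maximum of a concave quadratic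
functional, and passing to the marginals restricts this maximum to the observables of the subsystem.

An operator annihilating `ρ_{AB}` annihilates every extension `ρ_{ABV}`. Hence the extensions of a
pure state are products, and the extensions of a (anti)symmetric state are swap invariant, so that
`S_{AV} = S_{BV}`; weak monotonicity then says `S_A ≤ S_{AV}`, which the trivial extension attains.
Classically correlated states are symmetric, and the extension `∑ i, p i |iii⟩⟨iii|` makes
`I_{A:B|V}` vanish.
-/

noncomputable section

namespace QCorr

open Matrix Filter Topology

section Spectral

theorem isHermitian_diagonal_ofReal {X : Type*} [DecidableEq X] (p : X → ℝ) :
    (diagonal fun i => (p i : ℂ)).IsHermitian :=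
  isHermitian_diagonal_of_self_adjoint _ <| funext fun i => Complex.conj_ofReal (p i)

variable {X : Type*} [Fintype X] [DecidableEq X] {ρ σ : Matrix X X ℂ}

theorem cfc_eq_eigenvectorUnitary_conj (hρ : ρ.IsHermitian) (f : ℝ → ℝ) :
    cfc f ρ = (hρ.eigenvectorUnitary : Matrix X X ℂ) *
      diagonal (fun i => (f (hρ.eigenvalues i) : ℂ)) *
      (hρ.eigenvectorUnitary : Matrix X X ℂ)ᴴ := by
  rw [hρ.cfc_eq, IsHermitian.cfc, Unitary.conjStarAlgAut_apply]
  rfl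

theorem eq_eigenvectorUnitary_conj (hρ : ρ.IsHermitian) :
    ρ = (hρ.eigenvectorUnitary : Matrix X X ℂ) *
      diagonal (fun i => (hρ.eigenvalues i : ℂ)) * (hρ.eigenvectorUnitary : Matrix X X ℂ)ᴴ := by
  conv_lhs => rw [hρ.spectral_theorem, Unitary.conjStarAlgAut_apply]
  rfl

theorem conjTranspose_eigenvectorUnitary_mul (hρ : ρ.IsHermitian) :
    (hρ.eigenvectorUnitary : Matrix X X ℂ)ᴴ * hρ.eigenvectorUnitary = 1 :=
  Unitary.coe_star_mul_self _

theorem eigenvectorUnitary_mul_conjTranspose (hρ : ρ.IsHermitian) :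
    (hρ.eigenvectorUnitary : Matrix X X ℂ) * (hρ.eigenvectorUnitary : Matrix X X ℂ)ᴴ = 1 :=
  Unitary.coe_mul_star_self _

theorem mul_eigenvectorUnitary (hρ : ρ.IsHermitian) :
    ρ * hρ.eigenvectorUnitary =
      hρ.eigenvectorUnitary * diagonal (fun i => (hρ.eigenvalues i : ℂ)) := by
  refine (congrArg (· * (hρ.eigenvectorUnitary : Matrix X X ℂ))
    (eq_eigenvectorUnitary_conj hρ)).trans ?_
  rw [Matrix.mul_assoc, conjTranspose_eigenvectorUnitary_mul, Matrix.mul_one]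

theorem conjTranspose_eigenvectorUnitary_mul_self (hρ : ρ.IsHermitian) :
    (hρ.eigenvectorUnitary : Matrix X X ℂ)ᴴ * ρ =
      diagonal (fun i => (hρ.eigenvalues i : ℂ)) * (hρ.eigenvectorUnitary : Matrix X X ℂ)ᴴ := by
  simpa only [conjTranspose_mul, hρ.eq, (isHermitian_diagonal_ofReal _).eq] using
    congrArg conjTranspose (mul_eigenvectorUnitary hρ)

theorem mul_cfc_eq_cfc_mul (hρ : ρ.IsHermitian) (f : ℝ → ℝ) :
    ρ * cfc f ρ = cfc (fun x => x * f x) ρ := by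
  rw [cfc_mul (fun x => x) f ρ (finite_real_spectrum.continuousOn _)
    (finite_real_spectrum.continuousOn _), cfc_id' ℝ ρ hρ.isSelfAdjoint]

theorem trace_cfc (hρ : ρ.IsHermitian) (f : ℝ → ℝ) :
    (cfc f ρ).trace = ((∑ i, f (hρ.eigenvalues i) : ℝ) : ℂ) := by
  rw [cfc_eq_eigenvectorUnitary_conj hρ, trace_mul_comm, ← Matrix.mul_assoc,
    conjTranspose_eigenvectorUnitary_mul, Matrix.one_mul, trace_diagonal, Complex.ofReal_sum]

/-- The matrix of inner products between the eigenbases of two Hermitian matrices. -/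
def overlap (hρ : ρ.IsHermitian) (hσ : σ.IsHermitian) : Matrix X X ℂ :=
  (hρ.eigenvectorUnitary : Matrix X X ℂ)ᴴ * hσ.eigenvectorUnitary

theorem conjTranspose_overlap (hρ : ρ.IsHermitian) (hσ : σ.IsHermitian) :
    (overlap hρ hσ)ᴴ = overlap hσ hρ := by
  rw [overlap, conjTranspose_mul, conjTranspose_conjTranspose, overlap]

theorem trace_cfc_mul_cfc (hρ : ρ.IsHermitian) (hσ : σ.IsHermitian) (f g : ℝ → ℝ) :
    (cfc f ρ * cfc g σ).trace.re = ∑ i, ∑ j, Complex.normSq (overlap hρ hσ i j) *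
      (f (hρ.eigenvalues i) * g (hσ.eigenvalues j)) := by
  have cyclic : (cfc f ρ * cfc g σ).trace =
      (diagonal (fun i => (f (hρ.eigenvalues i) : ℂ)) * overlap hρ hσ *
        (diagonal (fun j => (g (hσ.eigenvalues j) : ℂ)) * (overlap hρ hσ)ᴴ)).trace := by
    rw [cfc_eq_eigenvectorUnitary_conj hρ, cfc_eq_eigenvectorUnitary_conj hσ, Matrix.mul_assoc,
      Matrix.mul_assoc, trace_mul_comm, conjTranspose_overlap, overlap, overlap]
    simp only [Matrix.mul_assoc]
  rw [cyclic, trace, Complex.re_sum]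
  refine Finset.sum_congr rfl fun i _ => ?_
  rw [diag_apply, mul_apply, Complex.re_sum]
  refine Finset.sum_congr rfl fun j _ => ?_
  have : (f (hρ.eigenvalues i) : ℂ) * overlap hρ hσ i j *
      (g (hσ.eigenvalues j) * star (overlap hρ hσ i j)) = Complex.normSq (overlap hρ hσ i j) *
        (f (hρ.eigenvalues i) * g (hσ.eigenvalues j)) := by
    rw [← Complex.mul_conj, Complex.star_def]
    ring
  rw [diagonal_mul, diagonal_mul, conjTranspose_apply, this]
  norm_cast

theorem overlap_mul_eigenvalues_eq_zero (hρ : ρ.IsHermitian) (hσ : σ.IsHermitian) (h : σ ∣ ρ)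
    {i j : X} (hj : hσ.eigenvalues j = 0) :
    overlap hρ hσ i j * hρ.eigenvalues i = 0 := by
  obtain ⟨M, hM⟩ := h
  have key : overlap hσ hρ * diagonal (fun i => (hρ.eigenvalues i : ℂ)) =
      diagonal (fun j => (hσ.eigenvalues j : ℂ)) *
        ((hσ.eigenvectorUnitary : Matrix X X ℂ)ᴴ * (M * hρ.eigenvectorUnitary)) := by
    rw [overlap, Matrix.mul_assoc, ← mul_eigenvectorUnitary, ← Matrix.mul_assoc (diagonal _),
      ← conjTranspose_eigenvectorUnitary_mul_self, Matrix.mul_assoc, ← Matrix.mul_assoc σ, ← hM]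
  have entry := congrFun (congrFun key j) i
  rw [mul_diagonal, diagonal_mul, hj, Complex.ofReal_zero, zero_mul, ← conjTranspose_overlap,
    conjTranspose_apply] at entry
  simpa using entry

theorem exists_mul_mul_self_eq {X : Type*} [Fintype X] {σ : Matrix X X ℂ} (hσ : σ.IsHermitian) :
    ∃ g, σ * g * σ = σ := by
  classical
  refine ⟨cfc (·⁻¹ : ℝ → ℝ) σ, ?_⟩
  conv_lhs => enter [2]; rw [← cfc_id' ℝ σ hσ.isSelfAdjoint]
  rw [mul_cfc_eq_cfc_mul hσ, ← cfc_mul _ _ σ (finite_real_spectrum.continuousOn _)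
    (finite_real_spectrum.continuousOn _)]
  simpa only [mul_inv_mul_cancel] using cfc_id' ℝ σ hσ.isSelfAdjoint

theorem dvd_iff_forall_mul_eq_zero {X : Type*} [Fintype X] {ρ σ : Matrix X X ℂ}
    (hσ : σ.IsHermitian) :
    σ ∣ ρ ↔ ∀ K, K * σ = 0 → K * ρ = 0 := by
  classical
  refine ⟨fun ⟨M, hM⟩ K hK => by rw [hM, ← Matrix.mul_assoc, hK, Matrix.zero_mul], fun h => ?_⟩
  obtain ⟨g, hg⟩ := exists_mul_mul_self_eq hσ
  have := h (1 - σ * g) (by rw [sub_mul, hg, one_mul, sub_self])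
  rw [sub_mul, one_mul, sub_eq_zero, Matrix.mul_assoc] at this
  exact ⟨_, this⟩

end Spectral

section Entropy

variable {X Y : Type*} [Fintype X] [DecidableEq X] [Fintype Y] [DecidableEq Y]

theorem entropy_eq_sum_eigenvalues {ρ : Matrix X X ℂ} (h : ρ.IsHermitian) :
    entropy ρ = ∑ i, Real.negMulLog (h.eigenvalues i) := by
  rw [entropy, mul_cfc_eq_cfc_mul h, trace_cfc h, Complex.ofReal_re, ← Finset.sum_neg_distrib]
  simp only [Real.negMulLog, neg_mul]

theorem entropy_eq_sum_roots {ρ : Matrix X X ℂ} (h : ρ.IsHermitian) :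
    entropy ρ = (ρ.charpoly.roots.map fun z : ℂ => Real.negMulLog z.re).sum := by
  rw [entropy_eq_sum_eigenvalues h, h.roots_charpoly_eq_eigenvalues, Multiset.map_map]
  rfl

/-- Zero eigenvalues do not contribute to the entropy, so powers of `X` are immaterial. -/
theorem entropy_eq_of_charpoly {ρ : Matrix X X ℂ} {σ : Matrix Y Y ℂ} (hρ : ρ.IsHermitian)
    (hσ : σ.IsHermitian) {m n : ℕ}
    (h : Polynomial.X ^ m * ρ.charpoly = Polynomial.X ^ n * σ.charpoly) :
    entropy ρ = entropy σ := by
  have sum_X_pow_mul (k : ℕ) {q : Polynomial ℂ} (hq : q ≠ 0) :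
      ((Polynomial.X ^ k * q).roots.map fun z : ℂ => Real.negMulLog z.re).sum =
        (q.roots.map fun z : ℂ => Real.negMulLog z.re).sum := by
    rw [Polynomial.roots_mul (mul_ne_zero (pow_ne_zero _ Polynomial.X_ne_zero) hq)]
    simp [Multiset.map_nsmul, Multiset.sum_nsmul]
  rw [entropy_eq_sum_roots hρ, entropy_eq_sum_roots hσ,
    ← sum_X_pow_mul m ρ.charpoly_monic.ne_zero, h, sum_X_pow_mul n σ.charpoly_monic.ne_zero]

theorem entropy_mul_conjTranspose (N : Matrix X Y ℂ) : entropy (N * Nᴴ) = entropy (Nᴴ * N) :=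
  entropy_eq_of_charpoly (isHermitian_mul_conjTranspose_self N)
    (isHermitian_conjTranspose_mul_self N) (charpoly_mul_comm' N Nᴴ)

theorem entropy_transpose {ρ : Matrix X X ℂ} (h : ρ.IsHermitian) : entropy ρᵀ = entropy ρ :=
  entropy_eq_of_charpoly (m := 0) (n := 0) h.transpose h (by rw [charpoly_transpose])

theorem entropy_submatrix_equiv {ρ : Matrix X X ℂ} (h : ρ.IsHermitian) (e : Y ≃ X) :
    entropy (ρ.submatrix e e) = entropy ρ :=
  entropy_eq_of_charpoly (m := 0) (n := 0) (h.submatrix e) h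
    (congrArg _ (charpoly_reindex e.symm ρ))

theorem entropy_diagonal (p : X → ℝ) :
    entropy (diagonal fun i => (p i : ℂ)) = ∑ i, Real.negMulLog (p i) := by
  rw [entropy_eq_sum_roots (isHermitian_diagonal_ofReal p), charpoly_diagonal,
    Polynomial.roots_prod _ _ (by simp [Finset.prod_ne_zero_iff, Polynomial.X_sub_C_ne_zero])]
  simp

theorem entropy_mul_diagonal_mul_conjTranspose {U : Matrix Y X ℂ} (hU : Uᴴ * U = 1) (p : X → ℝ) :
    entropy (U * diagonal (fun i => (p i : ℂ)) * Uᴴ) = ∑ i, Real.negMulLog (p i) := by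
  have hD := isHermitian_diagonal_ofReal p
  rw [← entropy_diagonal]
  refine entropy_eq_of_charpoly (isHermitian_mul_mul_conjTranspose U hD) hD
    (m := Fintype.card X) (n := Fintype.card Y) ?_
  rw [charpoly_mul_comm', ← Matrix.mul_assoc, hU, Matrix.one_mul]

theorem entropy_kronecker {ρ : Matrix X X ℂ} {σ : Matrix Y Y ℂ} (hρ : ρ.IsHermitian)
    (hσ : σ.IsHermitian) :
    entropy (ρ ⊗ₖ σ) = σ.trace.re * entropy ρ + ρ.trace.re * entropy σ := by
  set p := hρ.eigenvalues
  set q := hσ.eigenvalues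
  set U : Matrix X X ℂ := hρ.eigenvectorUnitary.val with hU
  set V : Matrix Y Y ℂ := hσ.eigenvectorUnitary.val with hV
  have diagonalization : ρ ⊗ₖ σ =
      (U ⊗ₖ V) * diagonal (fun k => ((p k.1 * q k.2 : ℝ) : ℂ)) * (U ⊗ₖ V)ᴴ := by
    have : (diagonal fun k : X × Y => ((p k.1 * q k.2 : ℝ) : ℂ)) =
        diagonal (fun i => (p i : ℂ)) ⊗ₖ diagonal (fun j => (q j : ℂ)) := by
      simp only [diagonal_kronecker_diagonal, Complex.ofReal_mul]
    rw [this, conjTranspose_kronecker, ← mul_kronecker_mul,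
      ← mul_kronecker_mul, ← eq_eigenvectorUnitary_conj hρ, ← eq_eigenvectorUnitary_conj hσ]
  have unitary : (U ⊗ₖ V)ᴴ * (U ⊗ₖ V) = 1 := by
    rw [conjTranspose_kronecker, ← mul_kronecker_mul, hU, hV, conjTranspose_eigenvectorUnitary_mul,
      conjTranspose_eigenvectorUnitary_mul, one_kronecker_one]
  rw [diagonalization, entropy_mul_diagonal_mul_conjTranspose unitary,
    entropy_eq_sum_eigenvalues hρ, entropy_eq_sum_eigenvalues hσ, hρ.trace_eq_sum_eigenvalues,
    hσ.trace_eq_sum_eigenvalues, Fintype.sum_prod_type]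
  simp only [Real.negMulLog_mul, Finset.sum_add_distrib, ← Finset.sum_mul, ← Finset.mul_sum]
  simp [p, q]

theorem IsState.entropy_kronecker {ρ : Matrix X X ℂ} {σ : Matrix Y Y ℂ} (hρ : IsState ρ)
    (hσ : IsState σ) : entropy (ρ ⊗ₖ σ) = entropy ρ + entropy σ := by
  rw [QCorr.entropy_kronecker hρ.posSemidef.1 hσ.posSemidef.1, hρ.trace_eq_one, hσ.trace_eq_one,
    Complex.one_re, one_mul, one_mul]

theorem IsState.entropy_nonneg {ρ : Matrix X X ℂ} (h : IsState ρ) : 0 ≤ entropy ρ := by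
  have hp := h.posSemidef.eigenvalues_nonneg
  have sum_eq_one : ∑ i, h.posSemidef.1.eigenvalues i = 1 := by
    have := h.posSemidef.1.trace_eq_sum_eigenvalues.symm.trans h.trace_eq_one
    simpa using congrArg Complex.re this
  rw [entropy_eq_sum_eigenvalues h.posSemidef.1]
  exact Finset.sum_nonneg fun i _ => Real.negMulLog_nonneg (hp i)
    (sum_eq_one ▸ Finset.single_le_sum (fun j _ => hp j) (Finset.mem_univ i))

end Entropy

section PosSemidef

variable {X : Type*} [Fintype X] {ρ σ : Matrix X X ℂ}

theorem exists_eq_conjTranspose_mul_self (hρ : ρ.PosSemidef) : ∃ R : Matrix X X ℂ, ρ = Rᴴ * R := by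
  classical
  open scoped MatrixOrder in
  exact CStarAlgebra.nonneg_iff_eq_star_mul_self.1 hρ.nonneg

theorem trace_mul_nonneg (hρ : ρ.PosSemidef) (hσ : σ.PosSemidef) : 0 ≤ (ρ * σ).trace := by
  obtain ⟨R, rfl⟩ := exists_eq_conjTranspose_mul_self hρ
  rw [Matrix.mul_assoc, trace_mul_comm]
  exact (hσ.mul_mul_conjTranspose_same R).trace_nonneg

theorem mul_eq_zero_iff_trace_eq_zero (hρ : ρ.PosSemidef) (K : Matrix X X ℂ) :
    K * ρ = 0 ↔ (ρ * (Kᴴ * K)).trace = 0 := by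
  obtain ⟨R, rfl⟩ := exists_eq_conjTranspose_mul_self hρ
  have trace_eq : (Rᴴ * R * (Kᴴ * K)).trace = ((K * Rᴴ) * (K * Rᴴ)ᴴ).trace := by
    rw [conjTranspose_mul, conjTranspose_conjTranspose, ← Matrix.mul_assoc, trace_mul_comm]
    simp only [Matrix.mul_assoc]
  rw [trace_eq, trace_mul_conjTranspose_self_eq_zero_iff, mul_conjTranspose_mul_self_eq_zero]

end PosSemidef

section Marginal

variable {X Z : Type*} [Fintype X] [DecidableEq X] [Fintype Z] [DecidableEq Z]

/-- `ρ'` is the marginal of `ρ` on the subsystem whose observables are embedded into the algebra of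
the whole system by `Φ`: the two have the same expectation values. -/
def IsMarginal (Φ : Matrix X X ℂ →⋆ₐ[ℂ] Matrix Z Z ℂ) (ρ : Matrix Z Z ℂ) (ρ' : Matrix X X ℂ) :
    Prop :=
  ∀ K, (ρ' * K).trace = (ρ * Φ K).trace

variable {Φ : Matrix X X ℂ →⋆ₐ[ℂ] Matrix Z Z ℂ} {ρ σ : Matrix Z Z ℂ} {ρ' σ' : Matrix X X ℂ}

theorem posSemidef_map (Φ : Matrix X X ℂ →⋆ₐ[ℂ] Matrix Z Z ℂ) (h : ρ'.PosSemidef) :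
    (Φ ρ').PosSemidef := by
  open scoped MatrixOrder in
  exact (map_nonneg Φ h.nonneg).posSemidef

theorem IsMarginal.trace_eq (h : IsMarginal Φ ρ ρ') : ρ'.trace = ρ.trace := by
  simpa using h 1

theorem IsMarginal.isHermitian (h : IsMarginal Φ ρ ρ') (hρ : ρ.IsHermitian) :
    ρ'.IsHermitian := by
  refine ext_iff_trace_mul_right.2 fun K => ?_
  calc (ρ'ᴴ * K).trace = star (ρ' * Kᴴ).trace := by
        rw [← trace_conjTranspose, conjTranspose_mul, conjTranspose_conjTranspose, trace_mul_comm]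
    _ = star (ρ * star (Φ K)).trace := by rw [h, ← star_eq_conjTranspose, map_star]
    _ = (ρ' * K).trace := by
        rw [← trace_conjTranspose, conjTranspose_mul, star_eq_conjTranspose,
          conjTranspose_conjTranspose, hρ.eq, trace_mul_comm, h]

theorem IsMarginal.posSemidef (h : IsMarginal Φ ρ ρ') (hρ : ρ.PosSemidef) : ρ'.PosSemidef := by
  refine .of_dotProduct_mulVec_nonneg (h.isHermitian hρ.1) fun x => ?_
  have expectation : star x ⬝ᵥ ρ' *ᵥ x = (ρ' * vecMulVec x (star x)).trace := by
    rw [mul_vecMulVec, trace_vecMulVec, dotProduct_comm]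
  rw [expectation, h]
  exact trace_mul_nonneg hρ (posSemidef_map Φ (posSemidef_vecMulVec_self_star x))

theorem IsMarginal.isState (h : IsMarginal Φ ρ ρ') (hρ : IsState ρ) : IsState ρ' :=
  ⟨h.posSemidef hρ.posSemidef, h.trace_eq.trans hρ.trace_eq_one⟩

theorem IsMarginal.map_mul_eq_zero_iff (h : IsMarginal Φ ρ ρ') (hρ : ρ.PosSemidef)
    (K : Matrix X X ℂ) : Φ K * ρ = 0 ↔ K * ρ' = 0 := by
  rw [mul_eq_zero_iff_trace_eq_zero hρ, mul_eq_zero_iff_trace_eq_zero (h.posSemidef hρ), h,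
    map_mul, ← star_eq_conjTranspose, ← star_eq_conjTranspose, map_star]

theorem IsMarginal.map_mul_eq_smul (h : IsMarginal Φ ρ ρ') (hρ : ρ.PosSemidef) {K : Matrix X X ℂ}
    {c : ℂ} (hK : K * ρ' = c • ρ') : Φ K * ρ = c • ρ := by
  have annihilates : Φ (K - c • 1) * ρ = 0 := by
    rw [h.map_mul_eq_zero_iff hρ, sub_mul, hK, smul_mul_assoc, Matrix.one_mul, sub_self]
  rwa [map_sub, map_smul, map_one, sub_mul, smul_mul_assoc, Matrix.one_mul, sub_eq_zero]
    at annihilates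

theorem IsMarginal.dvd_of_dvd (h : IsMarginal Φ ρ ρ') (hρ : ρ.PosSemidef)
    (h' : IsMarginal Φ σ σ') (hσ : σ.PosSemidef) (hσρ : σ ∣ ρ) : σ' ∣ ρ' := by
  rw [dvd_iff_forall_mul_eq_zero (h'.posSemidef hσ).1]
  intro K hK
  rw [← h.map_mul_eq_zero_iff hρ]
  exact (dvd_iff_forall_mul_eq_zero hσ.1).1 hσρ _ ((h'.map_mul_eq_zero_iff hσ K).2 hK)

end Marginal

section LogSums

variable {J K : Type*} [Fintype J] [Fintype K] {c p q : J → ℝ} {c' p' q' : K → ℝ}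

theorem hasDerivAt_sum_mul_log (h : ∀ j, c j ≠ 0 → 0 < p j ∧ 0 < q j) {t : ℝ} (ht : 0 ≤ t) :
    HasDerivAt (fun t => ∑ j, c j * Real.log (t * p j + q j))
      (∑ j, c j * (p j / (t * p j + q j))) t := by
  refine HasDerivAt.fun_sum fun j _ => ?_
  by_cases hc : c j = 0
  · simpa [hc] using hasDerivAt_const t (0 : ℝ)
  · obtain ⟨hp, hq⟩ := h j hc
    have linear : HasDerivAt (fun t => t * p j + q j) (p j) t := by
      simpa using ((hasDerivAt_id t).mul_const (p j)).add_const (q j)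
    exact (linear.log (by positivity)).const_mul (c j)

theorem tendsto_sum_mul_log_atTop (h : ∀ j, c j ≠ 0 → 0 < p j ∧ 0 < q j) :
    Tendsto (fun t => ∑ j, c j * Real.log (t * p j + q j) - (∑ j, c j) * Real.log t) atTop
      (𝓝 (∑ j, c j * Real.log (p j))) := by
  simp only [Finset.sum_mul, ← Finset.sum_sub_distrib]
  refine tendsto_finsetSum _ fun j _ => ?_
  by_cases hc : c j = 0
  · simp [hc]
  · obtain ⟨hp, hq⟩ := h j hc
    have quotient : Tendsto (fun t => p j + q j / t) atTop (𝓝 (p j)) := by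
      simpa using tendsto_const_nhds.add (tendsto_id.const_div_atTop (q j))
    refine ((quotient.log hp.ne').const_mul (c j)).congr' ?_
    filter_upwards [eventually_gt_atTop 0] with t ht
    have : t * p j + q j = t * (p j + q j / t) := by field_simp
    rw [this, Real.log_mul ht.ne' (by positivity)]
    ring

theorem sum_mul_log_sub_log_le (h : ∀ j, c j ≠ 0 → 0 < p j ∧ 0 < q j)
    (h' : ∀ k, c' k ≠ 0 → 0 < p' k ∧ 0 < q' k) (hsum : ∑ k, c' k = ∑ j, c j)
    (hle : ∀ t : ℝ, 0 < t →
      ∑ k, c' k * (p' k / (t * p' k + q' k)) ≤ ∑ j, c j * (p j / (t * p j + q j))) :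
    ∑ k, c' k * (Real.log (p' k) - Real.log (q' k)) ≤
      ∑ j, c j * (Real.log (p j) - Real.log (q j)) := by
  set G : ℝ → ℝ := fun t => ∑ j, c j * Real.log (t * p j + q j) -
    ∑ k, c' k * Real.log (t * p' k + q' k) with hG
  have deriv_G {t : ℝ} (ht : 0 ≤ t) : HasDerivAt G (∑ j, c j * (p j / (t * p j + q j)) -
      ∑ k, c' k * (p' k / (t * p' k + q' k))) t :=
    (hasDerivAt_sum_mul_log h ht).sub (hasDerivAt_sum_mul_log h' ht)
  have monotone_G : MonotoneOn G (Set.Ici 0) := by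
    refine monotoneOn_of_deriv_nonneg (convex_Ici 0)
      (fun t ht => (deriv_G ht).continuousAt.continuousWithinAt)
      (fun t ht => (deriv_G (interior_subset ht)).differentiableAt.differentiableWithinAt)
      fun t ht => ?_
    rw [(deriv_G (interior_subset ht)).deriv]
    exact sub_nonneg.2 (hle t (interior_Ici.subset ht))
  have tendsto_G :
      Tendsto G atTop (𝓝 (∑ j, c j * Real.log (p j) - ∑ k, c' k * Real.log (p' k))) := by
    refine ((tendsto_sum_mul_log_atTop h).sub (tendsto_sum_mul_log_atTop h')).congr fun t => ?_
    rw [hG, hsum]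
    ring
  have G_zero_le : G 0 ≤ ∑ j, c j * Real.log (p j) - ∑ k, c' k * Real.log (p' k) :=
    ge_of_tendsto tendsto_G <| (eventually_ge_atTop 0).mono fun t ht =>
      monotone_G Set.self_mem_Ici ht ht
  simp only [hG, zero_mul, zero_add] at G_zero_le
  simp only [mul_sub, Finset.sum_sub_distrib]
  linarith

end LogSums

section ModularForm

variable {X : Type*} [Fintype X] {ρ σ : Matrix X X ℂ}

/-- The concave quadratic functional in `K` whose maximum is the resolvent
`⟨√ρ, (Δ + t)⁻¹ √ρ⟩` of the relative modular operator `Δ` of `(σ, ρ)`. -/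
def modularForm (t : ℝ) (ρ σ K : Matrix X X ℂ) : ℝ :=
  2 * (ρ * K).trace.re - t * (ρ * (Kᴴ * K)).trace.re - (σ * (K * Kᴴ)).trace.re

theorem re_trace_mul_conjTranspose (hρ : ρ.IsHermitian) (M : Matrix X X ℂ) :
    (ρ * Mᴴ).trace.re = (ρ * M).trace.re := by
  rw [← Complex.conj_re, ← Complex.star_def, ← trace_conjTranspose, conjTranspose_mul,
    conjTranspose_conjTranspose, hρ.eq, trace_mul_comm]

theorem modularForm_add (hρ : ρ.IsHermitian) (hσ : σ.IsHermitian) {t : ℝ} {K : Matrix X X ℂ}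
    (hK : t • (K * ρ) + σ * K = ρ) (L : Matrix X X ℂ) :
    modularForm t ρ σ (K + L) = (ρ * K).trace.re -
      t * (ρ * (Lᴴ * L)).trace.re - (σ * (L * Lᴴ)).trace.re := by
  have polar (M : Matrix X X ℂ) :
      t * (ρ * (Mᴴ * K)).trace.re + (σ * (K * Mᴴ)).trace.re = (ρ * M).trace.re := by
    have : (ρ * (Mᴴ * K)).trace = (Mᴴ * (K * ρ)).trace := by
      rw [trace_mul_comm, Matrix.mul_assoc]
    rw [← re_trace_mul_conjTranspose hρ M, ← Matrix.mul_assoc σ, trace_mul_comm (σ * K), this,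
      trace_mul_comm ρ]
    conv_rhs => rw [← hK]
    rw [mul_add, trace_add, Matrix.mul_smul, trace_smul, Complex.add_re, Complex.smul_re,
      smul_eq_mul]
  have cross₁ := re_trace_mul_conjTranspose hρ (Lᴴ * K)
  have cross₂ := re_trace_mul_conjTranspose hσ (K * Lᴴ)
  have := polar K
  have := polar L
  simp only [conjTranspose_mul, conjTranspose_conjTranspose] at cross₁ cross₂
  simp only [modularForm, conjTranspose_add, mul_add, add_mul, trace_add, Complex.add_re, cross₁,
    cross₂]
  linarith

theorem modularForm_eq_of_add_eq (hρ : ρ.IsHermitian) (hσ : σ.IsHermitian) {t : ℝ}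
    {K : Matrix X X ℂ} (hK : t • (K * ρ) + σ * K = ρ) :
    modularForm t ρ σ K = (ρ * K).trace.re := by
  simpa using modularForm_add hρ hσ hK 0

theorem modularForm_le_of_add_eq (hρ : ρ.PosSemidef) (hσ : σ.PosSemidef) {t : ℝ} (ht : 0 ≤ t)
    {K : Matrix X X ℂ} (hK : t • (K * ρ) + σ * K = ρ) (L : Matrix X X ℂ) :
    modularForm t ρ σ L ≤ (ρ * K).trace.re := by
  have h₁ : 0 ≤ (ρ * ((L - K)ᴴ * (L - K))).trace.re :=
    (Complex.le_def.1 (trace_mul_nonneg hρ (posSemidef_conjTranspose_mul_self _))).1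
  have h₂ : 0 ≤ (σ * ((L - K) * (L - K)ᴴ)).trace.re :=
    (Complex.le_def.1 (trace_mul_nonneg hσ (posSemidef_self_mul_conjTranspose _))).1
  rw [← add_sub_cancel K L, modularForm_add hρ.1 hσ.1 hK]
  linarith [mul_nonneg ht h₁]

end ModularForm

section RelativeEntropy

variable {X Z : Type*} [Fintype X] [DecidableEq X] [Fintype Z] [DecidableEq Z]

/-- The quantum relative entropy `D(ρ ‖ σ) = Tr ρ (log ρ - log σ)`. The value is meaningful only if
the support of `ρ` is contained in that of `σ`, which is expressed below by `σ ∣ ρ`; the value `∞`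
of the remaining case is not represented. -/
def relEntropy (ρ σ : Matrix X X ℂ) : ℝ :=
  (ρ * (cfc Real.log ρ - cfc Real.log σ)).trace.re

variable {ρ σ : Matrix X X ℂ}

theorem relEntropy_eq_sum (hρ : ρ.IsHermitian) (hσ : σ.IsHermitian) :
    relEntropy ρ σ = ∑ k : X × X,
      Complex.normSq (overlap hρ hσ k.1 k.2) * hρ.eigenvalues k.1 *
        (Real.log (hρ.eigenvalues k.1) - Real.log (hσ.eigenvalues k.2)) := by
  have h₁ := trace_cfc_mul_cfc hρ hσ (fun x => x * Real.log x) (fun _ => 1)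
  have h₂ := trace_cfc_mul_cfc hρ hσ (fun x => x) Real.log
  rw [cfc_const_one ℝ σ hσ.isSelfAdjoint, mul_one, ← mul_cfc_eq_cfc_mul hρ] at h₁
  rw [cfc_id' ℝ ρ hρ.isSelfAdjoint] at h₂
  rw [relEntropy, mul_sub, trace_sub, Complex.sub_re, h₁, h₂, Fintype.sum_prod_type]
  simp only [← Finset.sum_sub_distrib]
  refine Finset.sum_congr rfl fun i _ => Finset.sum_congr rfl fun j _ => ?_
  ring

theorem trace_re_eq_sum (hρ : ρ.IsHermitian) (hσ : σ.IsHermitian) :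
    ρ.trace.re =
      ∑ k : X × X, Complex.normSq (overlap hρ hσ k.1 k.2) * hρ.eigenvalues k.1 := by
  have h := trace_cfc_mul_cfc hρ hσ (fun x => x) (fun _ => 1)
  rw [cfc_id' ℝ ρ hρ.isSelfAdjoint, cfc_const_one ℝ σ hσ.isSelfAdjoint, mul_one] at h
  simpa only [mul_one, Fintype.sum_prod_type] using h

theorem eigenvalues_pos_of_overlap_ne_zero (hρ : ρ.PosSemidef) (hσ : σ.PosSemidef) (h : σ ∣ ρ)
    (k : X × X) (hk : Complex.normSq (overlap hρ.1 hσ.1 k.1 k.2) * hρ.1.eigenvalues k.1 ≠ 0) :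
    0 < hρ.1.eigenvalues k.1 ∧ 0 < hσ.1.eigenvalues k.2 := by
  obtain ⟨overlap_ne, eigenvalue_ne⟩ := mul_ne_zero_iff.1 hk
  refine ⟨(hρ.eigenvalues_nonneg _).lt_of_ne' eigenvalue_ne,
    (hσ.eigenvalues_nonneg _).lt_of_ne' fun hq => ?_⟩
  have := overlap_mul_eigenvalues_eq_zero hρ.1 hσ.1 h (i := k.1) hq
  simp_all

/-- The solution `K` of `t K ρ + σ K = ρ`, which maximizes `modularForm t ρ σ`. In the eigenbases of
`σ` and `ρ` its entries are those of `overlap` multiplied by `p / (t p + q)`. -/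
def modularResolvent (hρ : ρ.IsHermitian) (hσ : σ.IsHermitian) (t : ℝ) : Matrix X X ℂ :=
  (hσ.eigenvectorUnitary : Matrix X X ℂ) *
    of (fun j i => overlap hσ hρ j i *
      ((hρ.eigenvalues i / (t * hρ.eigenvalues i + hσ.eigenvalues j) : ℝ) : ℂ)) *
    (hρ.eigenvectorUnitary : Matrix X X ℂ)ᴴ

theorem smul_modularResolvent_mul_add_mul (hρ : ρ.PosSemidef) (hσ : σ.PosSemidef) {t : ℝ}
    (ht : 0 < t) :
    t • (modularResolvent hρ.1 hσ.1 t * ρ) + σ * modularResolvent hρ.1 hσ.1 t = ρ := by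
  set p := hρ.1.eigenvalues
  set q := hσ.1.eigenvalues
  set U : Matrix X X ℂ := hρ.1.eigenvectorUnitary.val
  set V : Matrix X X ℂ := hσ.1.eigenvectorUnitary.val
  set Y : Matrix X X ℂ := of fun j i =>
    overlap hσ.1 hρ.1 j i * ((p i / (t * p i + q j) : ℝ) : ℂ) with hY
  have entrywise : t • (Y * diagonal fun i => (p i : ℂ)) + (diagonal fun j => (q j : ℂ)) * Y =
      overlap hσ.1 hρ.1 * diagonal fun i => (p i : ℂ) := by
    ext j i
    have cancel : p i / (t * p i + q j) * (t * p i + q j) = p i := by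
      refine div_mul_cancel_of_imp fun h => ?_
      have := hρ.eigenvalues_nonneg i
      have := hσ.eigenvalues_nonneg j
      nlinarith
    have : ((p i / (t * p i + q j) : ℝ) : ℂ) * (t * p i + q j) = p i := mod_cast cancel
    rw [Matrix.add_apply, Matrix.smul_apply, mul_diagonal, diagonal_mul, mul_diagonal, hY, of_apply,
      Complex.real_smul]
    linear_combination overlap hσ.1 hρ.1 j i * this
  have hUρ : Uᴴ * ρ = diagonal (fun i => (p i : ℂ)) * Uᴴ :=
    conjTranspose_eigenvectorUnitary_mul_self hρ.1
  have hσV : σ * V = V * diagonal fun j => (q j : ℂ) := mul_eigenvectorUnitary hσ.1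
  calc t • (V * Y * Uᴴ * ρ) + σ * (V * Y * Uᴴ)
      = V * (t • (Y * diagonal fun i => (p i : ℂ)) + (diagonal fun j => (q j : ℂ)) * Y) * Uᴴ := by
        rw [Matrix.mul_assoc (V * Y), hUρ, ← Matrix.mul_assoc σ, ← Matrix.mul_assoc σ, hσV, mul_add,
          add_mul, Matrix.mul_smul, Matrix.smul_mul]
        simp only [Matrix.mul_assoc]
    _ = V * Vᴴ * (U * diagonal (fun i => (p i : ℂ)) * Uᴴ) := by
        rw [entrywise, overlap]
        simp only [Matrix.mul_assoc, U, V]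
    _ = ρ := by
        rw [eigenvectorUnitary_mul_conjTranspose, Matrix.one_mul]
        exact (eq_eigenvectorUnitary_conj hρ.1).symm

theorem re_trace_mul_modularResolvent (hρ : ρ.IsHermitian) (hσ : σ.IsHermitian) (t : ℝ) :
    (ρ * modularResolvent hρ hσ t).trace.re = ∑ k : X × X,
      Complex.normSq (overlap hρ hσ k.1 k.2) * hρ.eigenvalues k.1 *
        (hρ.eigenvalues k.1 / (t * hρ.eigenvalues k.1 + hσ.eigenvalues k.2)) := by
  set Y : Matrix X X ℂ := of fun j i => overlap hσ hρ j i *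
    ((hρ.eigenvalues i / (t * hρ.eigenvalues i + hσ.eigenvalues j) : ℝ) : ℂ) with hY
  have cyclic : (ρ * modularResolvent hρ hσ t).trace =
      (diagonal (fun i => (hρ.eigenvalues i : ℂ)) * (overlap hρ hσ * Y)).trace := by
    rw [modularResolvent, ← hY, ← Matrix.mul_assoc, trace_mul_comm, ← Matrix.mul_assoc,
      conjTranspose_eigenvectorUnitary_mul_self, overlap]
    simp only [Matrix.mul_assoc]
  rw [cyclic, trace, Complex.re_sum, Fintype.sum_prod_type]
  refine Finset.sum_congr rfl fun i _ => ?_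
  rw [diag_apply, diagonal_mul, mul_apply, Finset.mul_sum, Complex.re_sum]
  refine Finset.sum_congr rfl fun j _ => ?_
  have normSq : overlap hρ hσ i j * overlap hσ hρ j i = Complex.normSq (overlap hρ hσ i j) := by
    rw [← conjTranspose_overlap hρ hσ, conjTranspose_apply, Complex.star_def, Complex.mul_conj]
  rw [hY, of_apply, ← mul_assoc (overlap hρ hσ i j), normSq]
  norm_cast
  ring

variable {Φ : Matrix X X ℂ →⋆ₐ[ℂ] Matrix Z Z ℂ} {ω τ : Matrix Z Z ℂ}

theorem IsMarginal.modularForm_eq (hρ : IsMarginal Φ ω ρ) (hσ : IsMarginal Φ τ σ) (t : ℝ)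
    (K : Matrix X X ℂ) : modularForm t ρ σ K = modularForm t ω τ (Φ K) := by
  rw [modularForm, modularForm, hρ K, hρ (Kᴴ * K), hσ (K * Kᴴ), map_mul, map_mul,
    ← star_eq_conjTranspose, ← star_eq_conjTranspose, map_star]

theorem IsMarginal.relEntropy_le (hρ : IsMarginal Φ ω ρ) (hσ : IsMarginal Φ τ σ)
    (hω : ω.PosSemidef) (hτ : τ.PosSemidef) (h : τ ∣ ω) : relEntropy ρ σ ≤ relEntropy ω τ := by
  have psd_ρ := hρ.posSemidef hω
  have psd_σ := hσ.posSemidef hτ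
  rw [relEntropy_eq_sum psd_ρ.1 psd_σ.1, relEntropy_eq_sum hω.1 hτ.1]
  refine sum_mul_log_sub_log_le (eigenvalues_pos_of_overlap_ne_zero hω hτ h)
    (eigenvalues_pos_of_overlap_ne_zero psd_ρ psd_σ (hρ.dvd_of_dvd hω hσ hτ h)) ?_ fun t ht => ?_
  · rw [← trace_re_eq_sum, ← trace_re_eq_sum, hρ.trace_eq]
  · rw [← re_trace_mul_modularResolvent, ← re_trace_mul_modularResolvent,
      ← modularForm_eq_of_add_eq psd_ρ.1 psd_σ.1 (smul_modularResolvent_mul_add_mul psd_ρ psd_σ ht),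
      hρ.modularForm_eq hσ]
    exact modularForm_le_of_add_eq hω hτ ht.le (smul_modularResolvent_mul_add_mul hω hτ ht) _

end RelativeEntropy

section PartialTrace

variable {X Y A B V : Type*}

theorem trace_trRight_mul [Fintype X] [Fintype Y] [DecidableEq Y] (ρ : Matrix (X × Y) (X × Y) ℂ)
    (K : Matrix X X ℂ) :
    (trRight ρ * K).trace = (ρ * K ⊗ₖ (1 : Matrix Y Y ℂ)).trace := by
  simp only [trace, diag_apply, Matrix.mul_apply, trRight, of_apply, Fintype.sum_prod_type,
    kroneckerMap_apply, Matrix.one_apply, mul_ite, mul_one, mul_zero, Finset.sum_ite_eq',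
    Finset.mem_univ, if_true, Finset.sum_mul]
  exact Finset.sum_congr rfl fun x _ => Finset.sum_comm

theorem trLeft_margAV [Fintype A] [Fintype B] (σ : Matrix ((A × B) × V) ((A × B) × V) ℂ) :
    trLeft (margAV σ) = trLeft σ := by
  ext v v'
  simp only [trLeft, margAV, of_apply, Fintype.sum_prod_type]

theorem trLeft_margBV [Fintype A] [Fintype B] (σ : Matrix ((A × B) × V) ((A × B) × V) ℂ) :
    trLeft (margBV σ) = trLeft σ := by
  ext v v'
  simp only [trLeft, margBV, of_apply, Fintype.sum_prod_type_right]

end PartialTrace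

section Subsystems

variable {X Y Z : Type*} [Fintype X] [DecidableEq X] [Fintype Y] [DecidableEq Y] [Fintype Z]
  [DecidableEq Z]

/-- The embedding `K ↦ K ⊗ 1` of the observables of the subsystem `X` into those of the system `Z`,
given an identification `e` of the basis of `Z` with that of `X ⊗ Y`. -/
def subsystemHom (e : Z ≃ X × Y) : Matrix X X ℂ →⋆ₐ[ℂ] Matrix Z Z ℂ where
  toFun K := (K ⊗ₖ (1 : Matrix Y Y ℂ)).submatrix e e
  map_one' := by rw [one_kronecker_one, submatrix_one_equiv]
  map_mul' K L := by rw [submatrix_mul_equiv, ← mul_kronecker_mul, Matrix.mul_one]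
  map_zero' := by rw [zero_kronecker, submatrix_zero]; rfl
  map_add' K L := by rw [add_kronecker, submatrix_add]; rfl
  commutes' c := by
    rw [Algebra.algebraMap_eq_smul_one, Algebra.algebraMap_eq_smul_one, smul_kronecker,
      one_kronecker_one, submatrix_smul]
    simp
  map_star' K := by
    simp only [star_eq_conjTranspose, conjTranspose_submatrix, conjTranspose_kronecker,
      conjTranspose_one]

theorem subsystemHom_apply (e : Z ≃ X × Y) (K : Matrix X X ℂ) :
    subsystemHom e K = (K ⊗ₖ (1 : Matrix Y Y ℂ)).submatrix e e :=
  rfl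

theorem isMarginal_subsystemHom (e : Z ≃ X × Y) (ρ : Matrix Z Z ℂ) :
    IsMarginal (subsystemHom e) ρ (trRight (ρ.submatrix e.symm e.symm)) := by
  intro K
  set M : Matrix (X × Y) (X × Y) ℂ := K ⊗ₖ 1
  have reindex : ρ.submatrix e.symm e.symm * M = (ρ * M.submatrix e e).submatrix e.symm e.symm := by
    rw [← submatrix_mul_equiv _ _ _ e.symm, submatrix_submatrix, e.self_comp_symm, submatrix_id_id]
  rw [trace_trRight_mul, reindex]
  exact e.symm.sum_comp fun z => (ρ * M.submatrix e e) z z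

theorem isMarginal_trRight (ρ : Matrix (X × Y) (X × Y) ℂ) :
    IsMarginal (subsystemHom (Equiv.refl _)) ρ (trRight ρ) :=
  isMarginal_subsystemHom (Equiv.refl _) ρ

theorem isMarginal_trLeft (ρ : Matrix (X × Y) (X × Y) ℂ) :
    IsMarginal (subsystemHom (Equiv.prodComm X Y)) ρ (trLeft ρ) :=
  isMarginal_subsystemHom (Equiv.prodComm X Y) ρ

variable {A B V : Type*} [Fintype A] [DecidableEq A] [Fintype B] [DecidableEq B]
  [Fintype V] [DecidableEq V]

theorem isMarginal_margBV (σ : Matrix ((A × B) × V) ((A × B) × V) ℂ) :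
    IsMarginal (subsystemHom ((Equiv.prodAssoc A B V).trans (Equiv.prodComm A (B × V)))) σ
      (margBV σ) :=
  isMarginal_subsystemHom _ σ

/-- The identification `AB ⊗ V ≃ AV ⊗ B`. -/
def prodRightComm (A B V : Type*) : (A × B) × V ≃ (A × V) × B :=
  ((Equiv.prodAssoc A B V).trans ((Equiv.refl A).prodCongr (Equiv.prodComm B V))).trans
    (Equiv.prodAssoc A V B).symm

theorem isMarginal_margAV (σ : Matrix ((A × B) × V) ((A × B) × V) ℂ) :
    IsMarginal (subsystemHom (prodRightComm A B V)) σ (margAV σ) :=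
  isMarginal_subsystemHom _ σ

end Subsystems

section StrongSubadditivity

variable {X Z : Type*} [Fintype X] [DecidableEq X] [Fintype Z] [DecidableEq Z]
  {Φ : Matrix X X ℂ →⋆ₐ[ℂ] Matrix Z Z ℂ} {ρ : Matrix Z Z ℂ} {ρ' : Matrix X X ℂ}

theorem IsMarginal.map_dvd (h : IsMarginal Φ ρ ρ') (hρ : ρ.PosSemidef) : Φ ρ' ∣ ρ := by
  obtain ⟨g, hg⟩ := exists_mul_mul_self_eq (h.posSemidef hρ).1
  have annihilates : Φ (1 - ρ' * g) * ρ = 0 := by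
    rw [h.map_mul_eq_zero_iff hρ, sub_mul, hg, Matrix.one_mul, sub_self]
  rw [map_sub, map_one, map_mul, sub_mul, Matrix.one_mul, sub_eq_zero, Matrix.mul_assoc]
    at annihilates
  exact ⟨Φ g * ρ, annihilates⟩

theorem map_cfc (Φ : Matrix X X ℂ →⋆ₐ[ℂ] Matrix Z Z ℂ) (h : ρ'.IsHermitian) (f : ℝ → ℝ) :
    Φ (cfc f ρ') = cfc f (Φ ρ') :=
  StarAlgHom.map_cfc (Φ.restrictScalars ℝ) f ρ' (finite_real_spectrum.continuousOn _)
    (Φ.toLinearMap.restrictScalars ℝ).continuous_of_finiteDimensional h.isSelfAdjoint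
    (h.isSelfAdjoint.map Φ)

theorem IsMarginal.relEntropy_map (h : IsMarginal Φ ρ ρ') (hρ : ρ.IsHermitian) :
    relEntropy ρ (Φ ρ') = entropy ρ' - entropy ρ := by
  rw [relEntropy, ← map_cfc Φ (h.isHermitian hρ), mul_sub, trace_sub, ← h, Complex.sub_re, entropy,
    entropy]
  ring

variable {A B V : Type*} [Fintype A] [DecidableEq A] [Fintype B] [DecidableEq B]
  [Fintype V] [DecidableEq V]

theorem margAV_subsystemHom (ρ : Matrix (B × V) (B × V) ℂ) :
    margAV (subsystemHom ((Equiv.prodAssoc A B V).trans (Equiv.prodComm A (B × V))) ρ) =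
      subsystemHom (Equiv.prodComm A V) (trLeft ρ) := by
  ext x x'
  simp only [margAV, trLeft, subsystemHom_apply, of_apply, submatrix_apply, kroneckerMap_apply,
    Equiv.trans_apply, Equiv.prodAssoc_apply, Equiv.prodComm_apply, Prod.swap, Finset.sum_mul]

/-- Data processing under `Tr_B` for the pair `ρ_ABV`, `1 ⊗ ρ_BV`, whose relative entropy is
`S_BV - S_ABV`. -/
theorem condMutualInfo_nonneg {σ : Matrix ((A × B) × V) ((A × B) × V) ℂ} (h : σ.PosSemidef) :
    0 ≤ condMutualInfo σ := by
  set τ := subsystemHom ((Equiv.prodAssoc A B V).trans (Equiv.prodComm A (B × V))) (margBV σ)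
    with hτ
  have psd_τ : τ.PosSemidef := posSemidef_map _ ((isMarginal_margBV σ).posSemidef h)
  have marginal_τ : margAV τ = subsystemHom (Equiv.prodComm A V) (trLeft (margAV σ)) := by
    rw [hτ, margAV_subsystemHom, trLeft_margBV, trLeft_margAV]
  have data_processing := (isMarginal_margAV σ).relEntropy_le (isMarginal_margAV τ) h psd_τ
    ((isMarginal_margBV σ).map_dvd h)
  rw [marginal_τ, (isMarginal_trLeft _).relEntropy_map ((isMarginal_margAV σ).isHermitian h.1), hτ,
    (isMarginal_margBV σ).relEntropy_map h.1, trLeft_margAV] at data_processing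
  rw [condMutualInfo]
  linarith

end StrongSubadditivity

section Purification

variable {X Y : Type*} [Fintype X] [DecidableEq X] [Fintype Y] [DecidableEq Y]

theorem exists_trRight_pureOp_eq {X : Type*} [Fintype X] {ρ : Matrix X X ℂ} (h : ρ.PosSemidef) :
    ∃ ψ : X × X → ℂ, trRight (pureOp ψ) = ρ := by
  obtain ⟨R, rfl⟩ := exists_eq_conjTranspose_mul_self h
  refine ⟨fun x => star (R x.2 x.1), ?_⟩
  ext x x'
  simp [trRight, pureOp, vecMulVec_apply, Matrix.mul_apply]

theorem entropy_trRight_pureOp (ψ : X × Y → ℂ) :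
    entropy (trRight (pureOp ψ)) = entropy (trLeft (pureOp ψ)) := by
  let N : Matrix X Y ℂ := of fun x y => ψ (x, y)
  have trRight_eq : trRight (pureOp ψ) = N * Nᴴ := by
    ext x y
    simp [trRight, pureOp, N, vecMulVec_apply, Matrix.mul_apply]
  have trLeft_eq : trLeft (pureOp ψ) = (Nᴴ * N)ᵀ := by
    ext x y
    simp [trLeft, pureOp, N, vecMulVec_apply, Matrix.mul_apply, mul_comm]
  rw [trRight_eq, trLeft_eq, entropy_transpose (isHermitian_conjTranspose_mul_self N),
    entropy_mul_conjTranspose]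

variable {A B V : Type*} [Fintype A] [DecidableEq A] [Fintype B] [DecidableEq B]
  [Fintype V] [DecidableEq V]

theorem entropy_margBV_trRight_pureOp {E : Type*} [Fintype E] [DecidableEq E]
    (ψ : ((A × B) × V) × E → ℂ) :
    entropy (margBV (trRight (pureOp ψ))) = entropy (trRight (pureOp
      fun x : (E × A) × (B × V) => ψ (((x.1.2, x.2.1), x.2.2), x.1.1))) := by
  rw [entropy_trRight_pureOp]
  congr 1
  ext x x'
  simp only [margBV, trLeft, trRight, of_apply, pureOp, vecMulVec_apply, Pi.star_apply]
  rw [Fintype.sum_prod_type_right]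

/-- If `E` purifies `ρ_ABV`, this is strong subadditivity for `V` and `E` conditioned on `A`, since
`S_AE = S_BV` and `S_AVE = S_B`. -/
theorem entropy_add_entropy_le {σ : Matrix ((A × B) × V) ((A × B) × V) ℂ} (h : σ.PosSemidef) :
    entropy (trRight (trRight σ)) + entropy (trLeft (trRight σ)) ≤
      entropy (margAV σ) + entropy (margBV σ) := by
  obtain ⟨ψ, rfl⟩ := exists_trRight_pureOp_eq h
  set σ := trRight (pureOp ψ)
  let φ : (((V × ((A × B) × V)) × A) × B) → ℂ := fun x => ψ (((x.1.2, x.2), x.1.1.1), x.1.1.2)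
  have entropy_VEA : entropy (trRight (pureOp φ)) = entropy (trLeft (trRight σ)) := by
    rw [entropy_trRight_pureOp]
    congr 1
    ext b b'
    simp only [trLeft, trRight, of_apply, σ, φ, pureOp, vecMulVec_apply, Pi.star_apply]
    rw [Fintype.sum_prod_type_right]
    exact Finset.sum_congr rfl fun a _ => Fintype.sum_prod_type _
  have entropy_EA : entropy (margBV (trRight (pureOp φ))) = entropy (margBV σ) := by
    rw [entropy_margBV_trRight_pureOp ψ]
    congr 1
    ext x x'
    simp only [margBV, trRight, of_apply, φ, pureOp, vecMulVec_apply, Pi.star_apply]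
    rw [Fintype.sum_prod_type_right]
  have entropy_VA : entropy (margAV (trRight (pureOp φ))) = entropy (margAV σ) := by
    rw [← entropy_submatrix_equiv ((isMarginal_margAV σ).isHermitian h.1) (Equiv.prodComm V A)]
    congr 1
    ext x x'
    simp only [margAV, trRight, of_apply, σ, φ, pureOp, vecMulVec_apply, Pi.star_apply,
      submatrix_apply, Equiv.prodComm_apply, Prod.fst_swap, Prod.snd_swap]
    exact Finset.sum_comm
  have marginal_A : trLeft (trRight (pureOp φ)) = trRight (trRight σ) := by
    ext a a'
    simp only [trLeft, trRight, of_apply, σ, φ, pureOp, vecMulVec_apply, Pi.star_apply]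
    rw [Finset.sum_comm]
    exact Finset.sum_congr rfl fun b _ => Fintype.sum_prod_type _
  have ssa := condMutualInfo_nonneg
    ((isMarginal_trRight (pureOp φ)).posSemidef (posSemidef_vecMulVec_self_star φ))
  rw [condMutualInfo, entropy_VA, entropy_EA, entropy_VEA, marginal_A] at ssa
  linarith

end Purification

section Extensions

variable {X Y A B V : Type*}

theorem margAV_kronecker [Fintype B] (ρ : Matrix (A × B) (A × B) ℂ) (ω : Matrix V V ℂ) :
    margAV (ρ ⊗ₖ ω) = trRight ρ ⊗ₖ ω := by
  ext x y
  simp [margAV, trRight, Finset.sum_mul]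

theorem margBV_kronecker [Fintype A] (ρ : Matrix (A × B) (A × B) ℂ) (ω : Matrix V V ℂ) :
    margBV (ρ ⊗ₖ ω) = trLeft ρ ⊗ₖ ω := by
  ext x y
  simp [margBV, trLeft, Finset.sum_mul]

theorem trRight_kronecker [Fintype Y] (ρ : Matrix X X ℂ) (ω : Matrix Y Y ℂ) :
    trRight (ρ ⊗ₖ ω) = ω.trace • ρ := by
  ext x y
  simp [trRight, trace, ← Finset.mul_sum, mul_comm]

theorem trLeft_kronecker [Fintype X] (ρ : Matrix X X ℂ) (ω : Matrix Y Y ℂ) :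
    trLeft (ρ ⊗ₖ ω) = ρ.trace • ω := by
  ext x y
  simp [trLeft, trace, Finset.sum_mul]

theorem IsState.kronecker [Fintype X] [Fintype Y] {ρ : Matrix X X ℂ} {ω : Matrix Y Y ℂ}
    (hρ : IsState ρ) (hω : IsState ω) : IsState (ρ ⊗ₖ ω) :=
  ⟨hρ.posSemidef.kronecker hω.posSemidef, by
    rw [trace_kronecker, hρ.trace_eq_one, hω.trace_eq_one, mul_one]⟩

theorem IsState.trRight [Fintype X] [Fintype Y] {ρ : Matrix (X × Y) (X × Y) ℂ} (h : IsState ρ) :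
    IsState (trRight ρ) := by
  classical exact (isMarginal_trRight ρ).isState h

theorem IsState.trLeft [Fintype X] [Fintype Y] {ρ : Matrix (X × Y) (X × Y) ℂ} (h : IsState ρ) :
    IsState (trLeft ρ) := by
  classical exact (isMarginal_trLeft ρ).isState h

theorem isState_one [Fintype X] [Unique X] [DecidableEq X] : IsState (1 : Matrix X X ℂ) :=
  ⟨PosSemidef.one, by simp⟩

theorem entropy_one [Fintype X] [DecidableEq X] : entropy (1 : Matrix X X ℂ) = 0 := by
  simpa using entropy_diagonal fun _ : X => 1

variable [Fintype A] [Fintype B]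

theorem IsState.isExtension_kronecker_one {ρ : Matrix (A × B) (A × B) ℂ} (h : IsState ρ) :
    IsExtension ρ (ρ ⊗ₖ (1 : Matrix (Fin 1) (Fin 1) ℂ)) :=
  ⟨h.kronecker isState_one, by rw [trRight_kronecker, isState_one.trace_eq_one, one_smul]⟩

section Infimum

variable {f g : ∀ n : ℕ, Matrix ((A × B) × Fin n) ((A × B) × Fin n) ℂ → ℝ}
  {ρ : Matrix (A × B) (A × B) ℂ} {r : ℝ}

theorem infExt_eq (h : ∀ n σ, IsExtension ρ σ → r ≤ f n σ) {m : ℕ}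
    {τ : Matrix ((A × B) × Fin m) ((A × B) × Fin m) ℂ} (hτ : IsExtension ρ τ) (hf : f m τ = r) :
    infExt f ρ = (r : EReal) := by
  refine le_antisymm ?_ ?_
  · rw [← hf]
    exact iInf_le_of_le m (iInf_le_of_le τ (iInf_le _ hτ))
  · exact le_iInf fun n => le_iInf fun σ => le_iInf fun hσ => EReal.coe_le_coe_iff.2 (h n σ hσ)

theorem infExt_eq_of_forall_eq (hρ : IsState ρ) (h : ∀ n σ, IsExtension ρ σ → f n σ = r) :
    infExt f ρ = (r : EReal) :=
  have trivial_extension := hρ.isExtension_kronecker_one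
  infExt_eq (fun n σ hσ => (h n σ hσ).ge) trivial_extension (h _ _ trivial_extension)

theorem infExt_congr (h : ∀ n σ, IsExtension ρ σ → f n σ = g n σ) : infExt f ρ = infExt g ρ :=
  iInf_congr fun n => iInf_congr fun σ => iInf_congr fun hσ => by rw [h n σ hσ]

theorem coe_add_iInf {ι : Sort*} (r : ℝ) (f : ι → EReal) :
    (r : EReal) + ⨅ i, f i = ⨅ i, ((r : EReal) + f i) := by
  refine le_antisymm (le_iInf fun i => by gcongr; exact iInf_le f i) ?_
  rw [add_comm, ← EReal.sub_le_iff_le_add (by simp) (by simp)]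
  refine le_iInf fun i => ?_
  rw [EReal.sub_le_iff_le_add (by simp) (by simp), add_comm]
  exact iInf_le (fun i => (r : EReal) + f i) i

theorem infExt_const_add : infExt (fun n σ => r + f n σ) ρ = (r : EReal) + infExt f ρ := by
  simp only [infExt, coe_add_iInf, EReal.coe_add]

end Infimum

theorem EP_eq_of_forall_le [DecidableEq A] {ρ : Matrix (A × B) (A × B) ℂ} (hρ : IsState ρ)
    (h : ∀ n (σ : Matrix ((A × B) × Fin n) ((A × B) × Fin n) ℂ), IsExtension ρ σ →
      entropy (trRight ρ) ≤ fP σ) :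
    EP ρ = (entropy (trRight ρ) : EReal) := by
  refine infExt_eq h hρ.isExtension_kronecker_one ?_
  rw [fP, margAV_kronecker, hρ.trRight.entropy_kronecker isState_one, entropy_one, add_zero]

end Extensions

section PureStates

section

variable {X Y : Type*} [Fintype X] [Fintype Y]

theorem isState_pureOp {ψ : X → ℂ} (h : ∑ x, ‖ψ x‖ ^ 2 = 1) : IsState (pureOp ψ) := by
  refine ⟨posSemidef_vecMulVec_self_star ψ, ?_⟩
  rw [← Complex.ofReal_one, ← h]
  simp [pureOp, trace, vecMulVec_apply, Complex.mul_conj, Complex.normSq_eq_norm_sq]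

theorem star_dotProduct_self {ψ : X → ℂ} (h : ∑ x, ‖ψ x‖ ^ 2 = 1) : star ψ ⬝ᵥ ψ = 1 := by
  rw [← (isState_pureOp h).trace_eq_one, pureOp, trace_vecMulVec, dotProduct_comm]

theorem pureOp_mul_self {ψ : X → ℂ} (h : ∑ x, ‖ψ x‖ ^ 2 = 1) :
    pureOp ψ * pureOp ψ = pureOp ψ := by
  rw [pureOp, vecMulVec_mul_vecMulVec, star_dotProduct_self h, one_smul]

theorem exists_pureOp_kronecker_one_conj_eq [DecidableEq Y] (ψ : X → ℂ)
    (σ : Matrix (X × Y) (X × Y) ℂ) :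
    ∃ ω, (pureOp ψ ⊗ₖ (1 : Matrix Y Y ℂ)) * σ * (pureOp ψ ⊗ₖ (1 : Matrix Y Y ℂ)) =
      pureOp ψ ⊗ₖ ω := by
  refine ⟨of fun v w => ∑ y, ∑ x, star (ψ x) * σ (x, v) (y, w) * ψ y, ?_⟩
  ext ⟨x, v⟩ ⟨y, w⟩
  simp only [Matrix.mul_apply, Fintype.sum_prod_type, kroneckerMap_apply, Matrix.one_apply,
    mul_ite, mul_one, mul_zero, ite_mul, zero_mul, Finset.sum_ite_eq, Finset.sum_ite_eq',
    Finset.mem_univ, if_true, pureOp, vecMulVec_apply, Pi.star_apply, of_apply,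
    Finset.mul_sum, Finset.sum_mul]
  refine Finset.sum_congr rfl fun y' _ => Finset.sum_congr rfl fun x' _ => ?_
  ring

theorem eq_kronecker_of_trRight_eq_pureOp {ψ : X → ℂ} (h : ∑ x, ‖ψ x‖ ^ 2 = 1)
    {σ : Matrix (X × Y) (X × Y) ℂ} (hσ : σ.PosSemidef) (hψ : trRight σ = pureOp ψ) :
    σ = pureOp ψ ⊗ₖ trLeft σ := by
  classical
  have mul_left : (pureOp ψ ⊗ₖ (1 : Matrix Y Y ℂ)) * σ = σ :=
    ((isMarginal_trRight σ).map_mul_eq_smul hσ (K := pureOp ψ) (c := 1)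
      (by rw [hψ, pureOp_mul_self h, one_smul])).trans (one_smul ℂ σ)
  have mul_right : σ * (pureOp ψ ⊗ₖ (1 : Matrix Y Y ℂ)) = σ := by
    have := congrArg conjTranspose mul_left
    rwa [conjTranspose_mul, conjTranspose_kronecker, conjTranspose_one,
      (isState_pureOp h).posSemidef.1.eq, hσ.1.eq] at this
  obtain ⟨ω, hω⟩ := exists_pureOp_kronecker_one_conj_eq ψ σ
  rw [mul_left, mul_right] at hω
  rw [hω, trLeft_kronecker, (isState_pureOp h).trace_eq_one, one_smul]

theorem entropy_pureOp [DecidableEq X] {ψ : X → ℂ} (h : ∑ x, ‖ψ x‖ ^ 2 = 1) :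
    entropy (pureOp ψ) = 0 := by
  have replicateCol_mul : pureOp ψ = replicateCol Unit ψ * (replicateCol Unit ψ)ᴴ := by
    rw [pureOp, vecMulVec_eq Unit, conjTranspose_replicateCol]
  have mul_replicateCol : (replicateCol Unit ψ)ᴴ * replicateCol Unit ψ = 1 := by
    ext
    rw [conjTranspose_replicateCol, replicateRow_mul_replicateCol_apply, star_dotProduct_self h]
    rfl
  rw [replicateCol_mul, entropy_mul_conjTranspose, mul_replicateCol, entropy_one]

end

variable {A B V : Type*} [Fintype A] [Fintype B] [Fintype V] [DecidableEq V] {ψ : A × B → ℂ}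
  {σ : Matrix ((A × B) × V) ((A × B) × V) ℂ}

theorem entropy_margAV_of_isExtension_pureOp [DecidableEq A] (h : ∑ x, ‖ψ x‖ ^ 2 = 1)
    (hσ : IsExtension (pureOp ψ) σ) :
    entropy (margAV σ) = entropy (trRight (pureOp ψ)) + entropy (trLeft σ) := by
  rw [← (isState_pureOp h).trRight.entropy_kronecker hσ.isState.trLeft, ← margAV_kronecker,
    ← eq_kronecker_of_trRight_eq_pureOp h hσ.isState.posSemidef hσ.trRight_eq]

theorem entropy_margBV_of_isExtension_pureOp [DecidableEq B] (h : ∑ x, ‖ψ x‖ ^ 2 = 1)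
    (hσ : IsExtension (pureOp ψ) σ) :
    entropy (margBV σ) = entropy (trLeft (pureOp ψ)) + entropy (trLeft σ) := by
  rw [← (isState_pureOp h).trLeft.entropy_kronecker hσ.isState.trLeft, ← margBV_kronecker,
    ← eq_kronecker_of_trRight_eq_pureOp h hσ.isState.posSemidef hσ.trRight_eq]

theorem EP_pureOp [DecidableEq A] (h : ∑ x, ‖ψ x‖ ^ 2 = 1) :
    EP (pureOp ψ) = (entropy (trRight (pureOp ψ)) : EReal) := by
  refine EP_eq_of_forall_le (isState_pureOp h) fun n σ hσ => ?_
  rw [fP, entropy_margAV_of_isExtension_pureOp h hσ]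
  exact le_add_of_nonneg_right hσ.isState.trLeft.entropy_nonneg

variable [DecidableEq A] [DecidableEq B]

theorem entropy_of_isExtension_pureOp (h : ∑ x, ‖ψ x‖ ^ 2 = 1)
    (hσ : IsExtension (pureOp ψ) σ) : entropy σ = entropy (trLeft σ) := by
  conv_lhs => rw [eq_kronecker_of_trRight_eq_pureOp h hσ.isState.posSemidef hσ.trRight_eq]
  rw [(isState_pureOp h).entropy_kronecker hσ.isState.trLeft, entropy_pureOp h, zero_add]

theorem EQ_pureOp (h : ∑ x, ‖ψ x‖ ^ 2 = 1) :
    EQ (pureOp ψ) = (entropy (trRight (pureOp ψ)) : EReal) := by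
  refine infExt_eq_of_forall_eq (isState_pureOp h) fun n σ hσ => ?_
  rw [fQ, entropy_margAV_of_isExtension_pureOp h hσ, entropy_margBV_of_isExtension_pureOp h hσ,
    hσ.trRight_eq]
  ring

theorem ER_pureOp (h : ∑ x, ‖ψ x‖ ^ 2 = 1) :
    ER (pureOp ψ) = (entropy (trRight (pureOp ψ)) : EReal) := by
  refine infExt_eq_of_forall_eq (isState_pureOp h) fun n σ hσ => ?_
  rw [fR, entropy_margAV_of_isExtension_pureOp h hσ, entropy_of_isExtension_pureOp h hσ,
    hσ.trRight_eq, entropy_pureOp h]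
  ring

end PureStates

section Symmetric

variable {ι V X : Type*} [DecidableEq ι] [DecidableEq V] [Fintype X]

theorem swapOp_eq_one_submatrix :
    swapOp = (1 : Matrix (ι × ι) (ι × ι) ℂ).submatrix Prod.swap id := by
  ext x y
  simp [swapOp, Matrix.one_apply, Prod.swap_eq_iff_eq_swap]

theorem swapOp_kronecker_one_eq_one_submatrix :
    swapOp ⊗ₖ (1 : Matrix V V ℂ) =
      (1 : Matrix ((ι × ι) × V) ((ι × ι) × V) ℂ).submatrix (Prod.map Prod.swap id) id := by
  rw [swapOp_eq_one_submatrix, ← one_kronecker_one (m := ι × ι)]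
  rfl

variable [Fintype ι] [Fintype V]

theorem swapOp_mul {X : Type*} (M : Matrix (ι × ι) X ℂ) :
    swapOp (ι := ι) * M = M.submatrix Prod.swap id := by
  rw [swapOp_eq_one_submatrix]
  exact one_submatrix_mul Prod.swap (Equiv.refl _) M

theorem swapOp_kronecker_one_mul_mul (σ : Matrix ((ι × ι) × V) ((ι × ι) × V) ℂ) :
    swapOp ⊗ₖ (1 : Matrix V V ℂ) * σ * (swapOpᴴ ⊗ₖ (1 : Matrix V V ℂ)) =
      σ.submatrix (Prod.map Prod.swap id) (Prod.map Prod.swap id) := by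
  have adjoint := congrArg conjTranspose (swapOp_kronecker_one_eq_one_submatrix (ι := ι) (V := V))
  rw [conjTranspose_kronecker, conjTranspose_one, conjTranspose_submatrix, conjTranspose_one]
    at adjoint
  rw [adjoint, swapOp_kronecker_one_eq_one_submatrix]
  exact (congrArg (· * _) (one_submatrix_mul _ (Equiv.refl _) σ)).trans
    (mul_submatrix_one (Equiv.refl _) _ _)

theorem swapOp_mul_eq_smul_iff {M : Matrix (ι × ι) X ℂ} {c : ℂ} :
    swapOp (ι := ι) * M = c • M ↔ ∀ v i j, (M *ᵥ v) (j, i) = c * (M *ᵥ v) (i, j) := by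
  rw [ext_iff_mulVec]
  refine forall_congr' fun v => ?_
  rw [smul_mulVec, swapOp_mul, funext_iff, Prod.forall]
  rfl

theorem range_mulVecLin_le_symSubspace_iff {M : Matrix (ι × ι) X ℂ} :
    LinearMap.range M.mulVecLin ≤ symSubspace ι ↔ swapOp (ι := ι) * M = M := by
  have iff := swapOp_mul_eq_smul_iff (M := M) (c := 1)
  simp only [one_smul, one_mul] at iff
  rw [iff]
  exact ⟨fun h v => h ⟨v, rfl⟩, by rintro h _ ⟨v, rfl⟩; exact h v⟩

theorem range_mulVecLin_le_antisymSubspace_iff {M : Matrix (ι × ι) X ℂ} :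
    LinearMap.range M.mulVecLin ≤ antisymSubspace ι ↔ swapOp (ι := ι) * M = -M := by
  have iff := swapOp_mul_eq_smul_iff (M := M) (c := -1)
  simp only [neg_one_smul, neg_one_mul] at iff
  rw [iff]
  exact ⟨fun h v => h ⟨v, rfl⟩, by rintro h _ ⟨v, rfl⟩; exact h v⟩

theorem isSymOrAntisymState_iff {ρ : Matrix (ι × ι) (ι × ι) ℂ} :
    IsSymOrAntisymState ρ ↔
      IsState ρ ∧ ∃ ε : ℝ, ε * ε = 1 ∧ swapOp (ι := ι) * ρ = (ε : ℂ) • ρ := by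
  simp only [mul_self_eq_one_iff, or_and_right, exists_or, exists_eq_left, Complex.ofReal_one,
    Complex.ofReal_neg, one_smul, neg_one_smul, ← range_mulVecLin_le_symSubspace_iff,
    ← range_mulVecLin_le_antisymSubspace_iff]
  exact ⟨fun h => ⟨h.1, h.2⟩, fun h => ⟨h.1, h.2⟩⟩

namespace IsSymOrAntisymState

variable {ρ : Matrix (ι × ι) (ι × ι) ℂ} (h : IsSymOrAntisymState ρ)
  {σ : Matrix ((ι × ι) × V) ((ι × ι) × V) ℂ} (hσ : IsExtension ρ σ)
include h

include hσ in
theorem swap_extension :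
    swapOp ⊗ₖ (1 : Matrix V V ℂ) * σ * (swapOpᴴ ⊗ₖ (1 : Matrix V V ℂ)) = σ := by
  obtain ⟨-, ε, hε, hρ⟩ := isSymOrAntisymState_iff.1 h
  have mul_left : swapOp (ι := ι) ⊗ₖ (1 : Matrix V V ℂ) * σ = (ε : ℂ) • σ :=
    (isMarginal_trRight σ).map_mul_eq_smul hσ.isState.posSemidef (by rw [hσ.trRight_eq, hρ])
  have mul_right : σ * (swapOpᴴ ⊗ₖ (1 : Matrix V V ℂ)) = (ε : ℂ) • σ := by
    have := congrArg conjTranspose mul_left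
    rwa [conjTranspose_mul, conjTranspose_kronecker, conjTranspose_one, conjTranspose_smul,
      hσ.isState.posSemidef.1.eq, Complex.star_def, Complex.conj_ofReal] at this
  rw [mul_left, smul_mul_assoc, mul_right, smul_smul, ← Complex.ofReal_mul, hε,
    Complex.ofReal_one, one_smul]

omit [DecidableEq ι] [DecidableEq V] in
include hσ in
theorem margAV_eq : margAV σ = margBV σ := by
  classical
  conv_lhs => rw [← h.swap_extension hσ, swapOp_kronecker_one_mul_mul]
  rfl

omit [DecidableEq ι] in
theorem trRight_eq : trRight ρ = trLeft ρ := by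
  simpa only [margAV_kronecker, margBV_kronecker, trRight_kronecker, isState_one.trace_eq_one,
    one_smul] using congrArg QCorr.trRight (h.margAV_eq h.isState.isExtension_kronecker_one)

theorem EP_eq : EP ρ = (entropy (trRight ρ) : EReal) := by
  refine EP_eq_of_forall_le h.isState fun n σ hσ => ?_
  have weak_monotonicity := entropy_add_entropy_le hσ.isState.posSemidef
  rw [← h.margAV_eq hσ, hσ.trRight_eq, ← h.trRight_eq] at weak_monotonicity
  rw [fP]
  linarith

theorem EQ_eq : EQ ρ = (entropy (trRight ρ) : EReal) := by
  refine infExt_eq_of_forall_eq h.isState fun n σ hσ => ?_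
  rw [fQ, h.margAV_eq hσ, hσ.trRight_eq, ← h.trRight_eq]
  ring

theorem ER_eq : ER ρ = ((1 / 2 * entropy ρ : ℝ) : EReal) + Esq ρ := by
  rw [Esq, ← infExt_const_add, ER]
  refine infExt_congr fun n σ hσ => ?_
  rw [fR, condMutualInfo, ← h.margAV_eq hσ, hσ.trRight_eq]
  ring

end IsSymOrAntisymState

end Symmetric

section Additivity

theorem trRight_bipartiteTensor {A₁ B₁ A₂ B₂ : Type*} [Fintype B₁] [Fintype B₂]
    (ρ : Matrix (A₁ × B₁) (A₁ × B₁) ℂ) (τ : Matrix (A₂ × B₂) (A₂ × B₂) ℂ) :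
    trRight (bipartiteTensor ρ τ) = trRight ρ ⊗ₖ trRight τ := by
  ext x y
  simp only [trRight, bipartiteTensor, of_apply, kroneckerMap_apply, Fintype.sum_prod_type,
    Finset.sum_mul_sum]

theorem IsState.submatrix_equiv {X Y : Type*} [Fintype X] [Fintype Y] {ρ : Matrix X X ℂ}
    (h : IsState ρ) (e : Y ≃ X) : IsState (ρ.submatrix e e) :=
  ⟨h.posSemidef.submatrix e, (e.sum_comp fun x => ρ x x).trans h.trace_eq_one⟩

theorem IsState.bipartiteTensor {A₁ B₁ A₂ B₂ : Type*} [Fintype A₁] [Fintype B₁] [Fintype A₂]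
    [Fintype B₂] {ρ : Matrix (A₁ × B₁) (A₁ × B₁) ℂ} {τ : Matrix (A₂ × B₂) (A₂ × B₂) ℂ}
    (hρ : IsState ρ) (hτ : IsState τ) : IsState (bipartiteTensor ρ τ) :=
  (hρ.kronecker hτ).submatrix_equiv (Equiv.prodProdProdComm A₁ A₂ B₁ B₂)

theorem bipartiteTensor_smul_smul {A₁ B₁ A₂ B₂ : Type*} (ρ : Matrix (A₁ × B₁) (A₁ × B₁) ℂ)
    (τ : Matrix (A₂ × B₂) (A₂ × B₂) ℂ) (c d : ℂ) :
    bipartiteTensor (c • ρ) (d • τ) = (c * d) • bipartiteTensor ρ τ := by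
  ext
  simp only [bipartiteTensor, of_apply, Matrix.smul_apply, smul_mul_smul_comm]

variable {ι κ : Type*} [Fintype ι] [DecidableEq ι] [Fintype κ] [DecidableEq κ]
  {ρ : Matrix (ι × ι) (ι × ι) ℂ} {τ : Matrix (κ × κ) (κ × κ) ℂ}

theorem swapOp_mul_bipartiteTensor :
    swapOp (ι := ι × κ) * bipartiteTensor ρ τ = bipartiteTensor (swapOp * ρ) (swapOp * τ) := by
  simp only [swapOp_mul]
  rfl

omit [DecidableEq ι] [DecidableEq κ] in
theorem IsSymOrAntisymState.bipartiteTensor (hρ : IsSymOrAntisymState ρ)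
    (hτ : IsSymOrAntisymState τ) : IsSymOrAntisymState (bipartiteTensor ρ τ) := by
  classical
  obtain ⟨-, ε, hε, swap_ρ⟩ := isSymOrAntisymState_iff.1 hρ
  obtain ⟨-, δ, hδ, swap_τ⟩ := isSymOrAntisymState_iff.1 hτ
  refine isSymOrAntisymState_iff.2 ⟨hρ.isState.bipartiteTensor hτ.isState, ε * δ, ?_, ?_⟩
  · rw [mul_mul_mul_comm, hε, hδ, one_mul]
  · rw [swapOp_mul_bipartiteTensor, swap_ρ, swap_τ, bipartiteTensor_smul_smul, Complex.ofReal_mul]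

theorem EP_bipartiteTensor (hρ : IsSymOrAntisymState ρ) (hτ : IsSymOrAntisymState τ) :
    EP (bipartiteTensor ρ τ) = EP ρ + EP τ := by
  rw [(hρ.bipartiteTensor hτ).EP_eq, hρ.EP_eq, hτ.EP_eq, trRight_bipartiteTensor,
    hρ.isState.trRight.entropy_kronecker hτ.isState.trRight, EReal.coe_add]

end Additivity

section Classical

/-- The mixture `∑ i, p i |f i⟩⟨f i|` of basis states. With `f i = ii` it is the classically
correlated state and with `f i = iii` an extension of it; its marginals are obtained by composing
`f` with projections. -/
def classicalMixture {ι X : Type*} [Fintype ι] [DecidableEq X] (f : ι → X) (p : ι → ℝ) :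
    Matrix X X ℂ :=
  ∑ i, (p i : ℂ) • pureOp (Pi.single (f i) 1)

variable {ι X Y A B V : Type*} [Fintype ι] [DecidableEq X] [DecidableEq Y] [DecidableEq A]
  [DecidableEq B] [DecidableEq V] (p : ι → ℝ)

theorem classicalMixture_apply (f : ι → X) (x y : X) :
    classicalMixture f p x y = ∑ i, if f i = x ∧ f i = y then (p i : ℂ) else 0 := by
  simp only [classicalMixture, pureOp, Matrix.sum_apply, Matrix.smul_apply, vecMulVec_apply,
    Pi.star_apply, Pi.single_apply]
  refine Finset.sum_congr rfl fun i _ => ?_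
  by_cases hx : x = f i <;> by_cases hy : y = f i <;> simp [hx, hy, Ne.symm]

theorem classicalMixture_submatrix (f : ι → X) (e : Y ≃ X) :
    (classicalMixture f p).submatrix e e = classicalMixture (e.symm ∘ f) p := by
  ext
  simp only [submatrix_apply, classicalMixture_apply, Function.comp_apply, e.symm_apply_eq]

theorem trRight_classicalMixture [Fintype Y] (f : ι → X × Y) :
    trRight (classicalMixture f p) = classicalMixture (Prod.fst ∘ f) p := by
  ext x x'
  simp only [trRight, of_apply, classicalMixture_apply, Prod.ext_iff]
  rw [Finset.sum_comm]
  refine Finset.sum_congr rfl fun i _ => ?_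
  rw [Finset.sum_eq_single (f i).2 (fun y _ hy => if_neg fun h => hy h.1.2.symm) (by simp)]
  simp only [and_true, Function.comp_apply]

theorem trLeft_classicalMixture [Fintype X] (f : ι → X × Y) :
    trLeft (classicalMixture f p) = classicalMixture (Prod.snd ∘ f) p :=
  (congrArg trRight (classicalMixture_submatrix p f (Equiv.prodComm Y X))).trans
    (trRight_classicalMixture p _)

theorem margBV_classicalMixture [Fintype A] (f : ι → (A × B) × V) :
    margBV (classicalMixture f p) = classicalMixture (fun i => ((f i).1.2, (f i).2)) p :=
  (congrArg trRight (classicalMixture_submatrix p f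
    ((Equiv.prodAssoc A B V).trans (Equiv.prodComm A (B × V))).symm)).trans
      (trRight_classicalMixture p _)

theorem entropy_classicalMixture [Fintype X] {f : ι → X} (hf : Function.Injective f) :
    entropy (classicalMixture f p) = shannon p := by
  classical
  let N : Matrix X ι ℂ := (1 : Matrix X X ℂ).submatrix id f
  have mixture_eq : classicalMixture f p = N * diagonal (fun i => (p i : ℂ)) * Nᴴ := by
    ext x y
    rw [classicalMixture_apply, Matrix.mul_apply]
    refine Finset.sum_congr rfl fun i _ => ?_
    by_cases hx : x = f i <;> by_cases hy : y = f i <;>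
      simp [N, hx, hy, Matrix.one_apply, Ne.symm]
  have isometry : Nᴴ * N = 1 := by
    ext i j
    simp [N, Matrix.mul_apply, Matrix.one_apply, hf.eq_iff]
  rw [mixture_eq, entropy_mul_diagonal_mul_conjTranspose isometry, shannon,
    ← Finset.sum_neg_distrib]
  simp only [Real.negMulLog, neg_mul]

section

variable {p} (hp : ∀ i, 0 ≤ p i) (hsum : ∑ i, p i = 1)
include hp hsum

theorem isState_classicalMixture [Fintype X] (f : ι → X) : IsState (classicalMixture f p) := by
  have isState_single (i : ι) : IsState (pureOp (Pi.single (f i) (1 : ℂ))) :=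
    isState_pureOp (by simp [Pi.single_apply, apply_ite])
  refine ⟨posSemidef_sum _ fun i _ => (isState_single i).posSemidef.smul (by exact_mod_cast hp i),
    ?_⟩
  simp only [classicalMixture, trace_sum, trace_smul, (isState_single _).trace_eq_one, smul_eq_mul,
    mul_one]
  exact_mod_cast hsum

variable [DecidableEq ι]

theorem isSymOrAntisymState_classicalState : IsSymOrAntisymState (classicalState p) := by
  refine isSymOrAntisymState_iff.2 ⟨isState_classicalMixture hp hsum _, 1, one_mul 1, ?_⟩
  rw [swapOp_mul, Complex.ofReal_one, one_smul]
  ext ⟨i, j⟩ ⟨k, l⟩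
  rw [submatrix_apply]
  refine (classicalMixture_apply ..).trans (.trans ?_ (classicalMixture_apply ..).symm)
  simp [and_comm]

theorem isExtension_classicalMixture {n : ℕ} (f : ι → Fin n) :
    IsExtension (classicalState p) (classicalMixture (fun i => ((i, i), f i)) p) :=
  ⟨isState_classicalMixture hp hsum _, trRight_classicalMixture p _⟩

theorem Esq_classicalState : Esq (classicalState p) = 0 := by
  let copy := Fintype.equivFin ι
  have hcopy := isExtension_classicalMixture hp hsum copy
  refine infExt_eq (fun n σ hσ => ?_) hcopy ?_
  · have := condMutualInfo_nonneg hσ.isState.posSemidef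
    positivity
  · rw [condMutualInfo, (isSymOrAntisymState_classicalState hp hsum).margAV_eq hcopy,
      margBV_classicalMixture, trLeft_classicalMixture, entropy_classicalMixture,
      entropy_classicalMixture, entropy_classicalMixture]
    · ring
    all_goals exact fun i j hij => by simp_all

end

variable [DecidableEq ι]

theorem entropy_classicalState : entropy (classicalState p) = shannon p :=
  entropy_classicalMixture p fun _ _ h => congrArg Prod.fst h

theorem entropy_trRight_classicalState : entropy (trRight (classicalState p)) = shannon p :=
  (congrArg entropy (trRight_classicalMixture p _)).trans
    (entropy_classicalMixture p Function.injective_id)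

end Classical

end QCorr

end

open QCorr in
open scoped Kronecker in
theorem mainTheorem5 {A B ι κ : Type*} [Fintype A] [DecidableEq A] [Fintype B] [DecidableEq B]
    [Fintype ι] [DecidableEq ι] [Fintype κ] [DecidableEq κ] :
    -- pure states
    (∀ ψ : A × B → ℂ, ∑ x, ‖ψ x‖ ^ 2 = 1 →
      EP (pureOp ψ) = (entropy (trRight (pureOp ψ)) : EReal) ∧
      EQ (pureOp ψ) = (entropy (trRight (pureOp ψ)) : EReal) ∧
      ER (pureOp ψ) = (entropy (trRight (pureOp ψ)) : EReal) ∧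
      entropy (trRight (pureOp ψ)) = entropy (trLeft (pureOp ψ))) ∧
    -- classically correlated states
    (∀ p : ι → ℝ, (∀ i, 0 ≤ p i) → ∑ i, p i = 1 →
      entropy (trRight (classicalState p)) = shannon p ∧
      mutualInfo (classicalState p) = shannon p ∧
      EP (classicalState p) = (shannon p : EReal) ∧
      EQ (classicalState p) = (shannon p : EReal) ∧
      ER (classicalState p) = ((1 / 2 * shannon p : ℝ) : EReal)) ∧
    -- states supported on the symmetric or on the antisymmetric subspace
    (∀ ρ : Matrix (ι × ι) (ι × ι) ℂ, IsSymOrAntisymState ρ →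
      (∀ (n : ℕ) (σ : Matrix ((ι × ι) × Fin n) ((ι × ι) × Fin n) ℂ), IsExtension ρ σ →
        (swapOp ⊗ₖ (1 : Matrix (Fin n) (Fin n) ℂ)) * σ *
          ((swapOp : Matrix (ι × ι) (ι × ι) ℂ).conjTranspose ⊗ₖ
            (1 : Matrix (Fin n) (Fin n) ℂ)) = σ ∧
        entropy (margAV σ) = entropy (margBV σ)) ∧
      EP ρ = (entropy (trRight ρ) : EReal) ∧
      EQ ρ = (entropy (trRight ρ) : EReal) ∧
      ER ρ = ((1 / 2 * entropy ρ : ℝ) : EReal) + Esq ρ) ∧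
    -- additivity of the entanglement of purification on the latter class
    (∀ (ρ : Matrix (ι × ι) (ι × ι) ℂ) (τ : Matrix (κ × κ) (κ × κ) ℂ),
      IsSymOrAntisymState ρ → IsSymOrAntisymState τ →
      EP (bipartiteTensor ρ τ) = EP ρ + EP τ) := by
  refine ⟨fun ψ hψ => ⟨EP_pureOp hψ, EQ_pureOp hψ, ER_pureOp hψ, entropy_trRight_pureOp ψ⟩,
    fun p hp hsum => ?_,
    fun ρ hρ => ⟨fun n σ hσ => ⟨hρ.swap_extension hσ, congrArg entropy (hρ.margAV_eq hσ)⟩,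
      hρ.EP_eq, hρ.EQ_eq, hρ.ER_eq⟩,
    fun ρ τ hρ hτ => EP_bipartiteTensor hρ hτ⟩
  have symmetric := isSymOrAntisymState_classicalState hp hsum
  have entropy_A := entropy_trRight_classicalState p
  have entropy_AB := entropy_classicalState p
  refine ⟨entropy_A, ?_, by rw [symmetric.EP_eq, entropy_A], by rw [symmetric.EQ_eq, entropy_A], ?_⟩
  · rw [mutualInfo, ← symmetric.trRight_eq, entropy_A, entropy_AB, add_sub_cancel_right]
  · rw [symmetric.ER_eq, Esq_classicalState hp hsum, entropy_AB, add_zero]
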